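/- Let $m\ge 0$. A natural operator $O(\Gamma,X_1,\dots,X_n)$ on $m$-manifolds assigns to a smooth torsion-free linear connection $\Gamma$ and smooth vector fields $X_1,\dots,X_n$ on a smooth $m$-manifold a smooth vector field, $\mathbb R$-multilinearly in the $X_i$, such that in all coordinate charts of all $m$-manifolds the components of $O(\Gamma,X_1,\dots,X_n)$ are given by one and the same polynomial expression in the partial derivatives (of finitely many orders) of the Christoffel symbols $\Gamma^\lambda_{\mu\nu}$ and of the components of the $X_i$. A permutation $\tau\in\Sigma_n$ acts by $(O\tau)(\Gamma,X_1,\dots,X_n)=O(\Gamma,X_{\tau(1)},\dots,X_{\tau(n)})$, and this is extended linearly to $\mathfrak S=\sum_\tau s_\tau\tau\in\mathbb R[\Sigma_n]$ by $O\,\mathfrak S=\sum_\tau s_\tau\, O\tau$. For $n\ge 3$ let ${\rm Ush}(n-2,2)$ be the set of all $\sigma\in\Sigma_n$ with $\sigma(1)<\cdots<\sigma(n-2)$ and $\sigma(n-1)<\sigma(n)$, and let $E^0(n)$ be the $\Sigma_n$-module induced from the trivial representation of $\Sigma_{n-2}\times\Sigma_2$, i.e. the real vector space with a basis of symbols $[\sigma]$,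 $\sigma\in\Sigma_n$, where $[\sigma]=[\sigma']$ if and only if $\sigma'=\sigma\circ h$ with $h\in\Sigma_{n-2}\times\Sigma_2$, and $[\sigma]\cdot\tau=[\tau\circ\sigma]$. **Theorem E.** Let, for each $n\ge 3$, real numbers $\alpha_\sigma$, $\sigma\in{\rm Ush}(n-2,2)$, with $\sum_{\sigma}\alpha_\sigma=0$ be given. Then there exist natural operators $J_n(\Gamma,X_1,\dots,X_n)$, $n\ge 3$, on $m$-manifolds with the following two properties. (1) $J_n$ is of order $0$ in the vector fields and has the local expression $$J_n^\omega=\sum_{\sigma\in{\rm Ush}(n-2,2)}\alpha_\sigma\, X^{\rho_1}_{\sigma(1)}\cdots X^{\rho_n}_{\sigma(n)}\,\frac{\partial^{n-2}\Gamma^\omega_{\rho_{n-1}\rho_n}}{\partial x^{\rho_1}\cdots\partial x^{\rho_{n-2}}}+\text{l.o.t.},$$ where l.o.t. is a polynomial in the $X_i^\rho$ and in the partial derivatives of the Christoffel symbols of order $<n-2$. (2) Every quasi-symmetry of $J_n$ is a symmetry: if $\mathfrak S\in\mathbb R[\Sigma_n]$ annihilates the leading term, i.e. $\bigl(\sum_{\sigma\in{\rm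 Ush}(n-2,2)}\alpha_\sigma[\sigma]\bigr)\cdot\mathfrak S=0$ in $E^0(n)$, then $J_n\,\mathfrak S=0$. In other words, the generalized Bianchi-Ricci identities hold for the $J_n$ with zero right-hand sides. -/

import Mathlib

open scoped Manifold ContDiff Bundle Pointwise
open Bundle

universe u

/-! ## Symmetric linear connections and vector fields on smooth manifolds -/

/-- The model space `ℝᵐ`. -/
abbrev RealSpace (m : ℕ) : Type := EuclideanSpace ℝ (Fin m)

/-- A smooth torsion-free linear connection on the smooth `m`-manifold `M`. -/
structure SymConnection (m : ℕ) (M : Type*) [TopologicalSpace M] [ChartedSpace (RealSpace m) M]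
    [IsManifold (𝓡 m) ∞ M] where
  /-- The covariant derivative; `cov Y x (X x)` is `(∇_X Y)(x)`. -/
  cov : CovariantDerivative (𝓡 m) (RealSpace m) (TangentSpace (𝓡 m) : M → Type _)
  smooth : CovariantDerivative.ContMDiffCovariantDerivative cov ∞
  torsion_eq_zero : cov.torsion = 0

/-- Smooth vector fields on `M`. -/
abbrev SmoothVF (m : ℕ) (M : Type*) [TopologicalSpace M] [ChartedSpace (RealSpace m) M]
    [IsManifold (𝓡 m) ∞ M] : Type _ :=
  ContMDiffSection (𝓡 m) (RealSpace m) ∞ (TangentSpace (𝓡 m) : M → Type _)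

/-! ## Local coordinates -/

section Coordinates

variable {m : ℕ} {M : Type*} [TopologicalSpace M] [ChartedSpace (RealSpace m) M]

/-- The `i`-th standard basis vector of `ℝᵐ`. -/
noncomputable def basisVec (m : ℕ) (i : Fin m) : RealSpace m := EuclideanSpace.single i 1

/-- The coefficient at `∂/∂x^l` of a tangent vector `v` of `M` at `x`, in the chart `e`. -/
noncomputable def tangentCoord (e : OpenPartialHomeomorph M (RealSpace m)) (x : M)
    (v : TangentSpace (𝓡 m) x) (l : Fin m) : ℝ :=
  (EuclideanSpace.proj l : RealSpace m →L[ℝ] ℝ) (mfderiv (𝓡 m) (𝓡 m) e x v)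

/-- The coordinate vector field `∂/∂x^μ` of the chart `e` (meaningful on `e.source`). -/
noncomputable def coordField (e : OpenPartialHomeomorph M (RealSpace m)) (μ : Fin m) :
    (x : M) → TangentSpace (𝓡 m) x :=
  VectorField.mpullback (𝓡 m) (𝓡 m) e (fun _ => basisVec m μ)

/-- The coefficient `X^l` of a vector field in the chart `e`, as a function of the coordinates
(meaningful on `e.target`). -/
noncomputable def vfCoord [IsManifold (𝓡 m) ∞ M] (e : OpenPartialHomeomorph M (RealSpace m))
    (X : SmoothVF m M) (l : Fin m) (y : RealSpace m) : ℝ :=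
  tangentCoord e (e.symm y) (X (e.symm y)) l

/-- The Christoffel symbol `Γ^l_{μν}`, the coefficient at `∂/∂x^l` of
`∇_{∂/∂x^μ} (∂/∂x^ν)`, in the chart `e`, as a function of the coordinates
(meaningful on `e.target`). -/
noncomputable def christoffel [IsManifold (𝓡 m) ∞ M] (e : OpenPartialHomeomorph M (RealSpace m))
    (Γ : SymConnection m M) (l μ ν : Fin m) (y : RealSpace m) : ℝ :=
  tangentCoord e (e.symm y)
    (Γ.cov (coordField e ν) (e.symm y) (coordField e μ (e.symm y))) l

end Coordinates

/-- The iterated partial derivative `∂ᵏ f / ∂x^{ρ₁} ⋯ ∂x^{ρ_k}` at the point `y`. -/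
noncomputable def partialDeriv {m k : ℕ} (f : RealSpace m → ℝ) (ρ : Fin k → Fin m) (y : RealSpace m) : ℝ :=
  iteratedFDeriv ℝ k f y (fun i => basisVec m (ρ i))

/-! ## Natural differential operators `Con × T^{⊗ d} → T` -/

/-- The variables in which local expressions of operators are written: the partial derivatives,
of all orders `k ≥ 0`, of the Christoffel symbols and of the coefficients of `d` vector fields. -/
inductive JetVar (m d : ℕ) : Type
  /-- `∂ᵏ Γ^l_{μν} / ∂x^{ρ₁} ⋯ ∂x^{ρ_k}` -/
  | conn (k : ℕ) (ρ : Fin k → Fin m) (l μ ν : Fin m) : JetVar m d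
  /-- `∂ᵏ X_i^l / ∂x^{ρ₁} ⋯ ∂x^{ρ_k}` -/
  | vf (i : Fin d) (k : ℕ) (ρ : Fin k → Fin m) (l : Fin m) : JetVar m d

/-- The values of the jet variables for a connection and `d` vector fields on `M`, in the chart
`e`, at the point with coordinates `y`. -/
noncomputable def jetValue {m d : ℕ} {M : Type*} [TopologicalSpace M] [ChartedSpace (RealSpace m) M]
    [IsManifold (𝓡 m) ∞ M] (e : OpenPartialHomeomorph M (RealSpace m)) (Γ : SymConnection m M)
    (X : Fin d → SmoothVF m M) (y : RealSpace m) : JetVar m d → ℝ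
  | .conn _ ρ l μ ν => partialDeriv (christoffel e Γ l μ ν) ρ y
  | .vf i _ ρ l => partialDeriv (vfCoord e (X i) l) ρ y

/-- A rule that assigns, on each smooth `m`-manifold `M`, to a symmetric connection and `d` vector
fields a vector field, multilinearly in the vector fields. -/
abbrev OpFamily (m d : ℕ) : Type (u + 1) :=
  ∀ (M : Type u) [TopologicalSpace M] [ChartedSpace (RealSpace m) M] [IsManifold (𝓡 m) ∞ M]
    [T2Space M] [SecondCountableTopology M],
    SymConnection m M → MultilinearMap ℝ (fun _ : Fin d => SmoothVF m M) (SmoothVF m M)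

/-- `P` is a local expression of `O`: on every manifold and in *every* smooth chart, the
coefficients of `O(Γ, X₁, …, X_d)` are the polynomials `P` in the partial derivatives of the
Christoffel symbols of `Γ` and of the coefficients of the `X_i`. -/
def OpFamily.HasLocalExpression {m d : ℕ} (O : OpFamily.{u} m d)
    (P : Fin m → MvPolynomial (JetVar m d) ℝ) : Prop :=
  ∀ (M : Type u) [TopologicalSpace M] [ChartedSpace (RealSpace m) M] [IsManifold (𝓡 m) ∞ M]
    [T2Space M] [SecondCountableTopology M] (Γ : SymConnection m M) (X : Fin d → SmoothVF m M),
    ∀ e ∈ IsManifold.maximalAtlas (𝓡 m) ∞ M, ∀ y ∈ e.target, ∀ l : Fin m,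
      vfCoord e (O M Γ X) l y = MvPolynomial.eval (jetValue e Γ X y) (P l)

/-- The space `Nat(Con × T^{⊗ d}, T)` of natural (that is, coordinate-independent) polynomial
differential operators on `m`-manifolds: the operator is given by one and the same polynomial
expression in all coordinate charts of all `m`-manifolds. -/
structure NatOp (m d : ℕ) where
  /-- The operator on each manifold. -/
  op : OpFamily.{u} m d
  natural : ∃ P, op.HasLocalExpression P

/-! ## Leading terms, quasi-symmetries and symmetries

Throughout, `n = p + 2`. -/

/-- `(n-2, 2)`-unshuffles: permutations increasing on the first `p = n - 2` and on the last two
elements. -/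
def IsUnshuffle {p : ℕ} (σ : Equiv.Perm (Fin (p + 2))) : Prop :=
  (∀ i j : Fin p, i < j → σ (Fin.castAdd 2 i) < σ (Fin.castAdd 2 j)) ∧
    σ (Fin.natAdd p 0) < σ (Fin.natAdd p 1)

open Classical in
/-- The finite set `Ush(n-2, 2)`. -/
noncomputable def Ush (p : ℕ) : Finset (Equiv.Perm (Fin (p + 2))) :=
  Finset.univ.filter IsUnshuffle

/-- The leading term
`∑_{σ ∈ Ush(n-2,2)} α_σ X_{σ(1)}^{ρ₁} ⋯ X_{σ(n)}^{ρ_n}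
  ∂^{n-2} Γ^l_{ρ_{n-1} ρ_n} / ∂x^{ρ₁} ⋯ ∂x^{ρ_{n-2}}`. -/
noncomputable def leadingTerm (m : ℕ) {p : ℕ} (α : Equiv.Perm (Fin (p + 2)) → ℝ) (l : Fin m) :
    MvPolynomial (JetVar m (p + 2)) ℝ :=
  ∑ σ ∈ Ush p, MvPolynomial.C (α σ) * ∑ ρ : Fin (p + 2) → Fin m,
    (∏ i, MvPolynomial.X (JetVar.vf (σ i) 0 Fin.elim0 (ρ i))) *
      MvPolynomial.X (JetVar.conn p (fun i => ρ (Fin.castAdd 2 i)) l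
        (ρ (Fin.natAdd p 0)) (ρ (Fin.natAdd p 1)))

/-- Variables allowed in the lower order terms: partial derivatives of the Christoffel symbols of
order `< p`, and undifferentiated coefficients of the vector fields. -/
def JetVar.IsLower {m d : ℕ} (p : ℕ) : JetVar m d → Prop
  | .conn k _ _ _ _ => k < p
  | .vf _ k _ _ => k = 0

/-- The operator is of order `0` in the vector fields and its local expression is the leading term
with coefficients `α_σ` plus an expression of differential order `< n - 2`. -/
def NatOp.HasLeadingTerm {m p : ℕ} (D : NatOp.{u} m (p + 2))
    (α : Equiv.Perm (Fin (p + 2)) → ℝ) : Prop :=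
  ∃ Q : Fin m → MvPolynomial (JetVar m (p + 2)) ℝ,
    (∀ l, ∀ v ∈ (Q l).vars, v.IsLower p) ∧
      D.op.HasLocalExpression (fun l => leadingTerm m α l + Q l)

/-- The subgroup `Σ_{n-2} × Σ_2` of `Σ_n`. -/
def youngSubgroup (p : ℕ) : Subgroup (Equiv.Perm (Fin (p + 2))) :=
  MulAction.stabilizer (Equiv.Perm (Fin (p + 2))) {i : Fin (p + 2) | i.val < p}

/-- The `Σ_n`-module `E⁰(n)` induced from the trivial representation of `Σ_{n-2} × Σ_2`, as the
permutation module on the cosets. The class of `σ` is `(1_{n-2} × 1_2) σ` and stands for the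
monomial in `X_{σ(1)}, …, X_{σ(n)}` of the leading term; this monomial depends only on the coset
`σ (Σ_{n-2} × Σ_2)`, the product in `Equiv.Perm` being composition of maps. -/
abbrev InducedModule (p : ℕ) : Type :=
  (Equiv.Perm (Fin (p + 2)) ⧸ youngSubgroup p) →₀ ℝ

/-- The element `∑_{σ ∈ Ush(n-2,2)} α_σ (1_{n-2} × 1_2) σ` of `E⁰(n)`. -/
noncomputable def leadingElement {p : ℕ} (α : Equiv.Perm (Fin (p + 2)) → ℝ) : InducedModule p :=
  ∑ σ ∈ Ush p, Finsupp.single (QuotientGroup.mk σ) (α σ)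

/-- The action of the group ring on `E⁰(n)`. As a permutation `τ` acts on operators by
`O(X₁, …, X_n) ↦ O(X_{τ(1)}, …, X_{τ(n)})`, it sends the monomial of `σ` to that of `τ ∘ σ`. (This
is a right action for permutations multiplied from left to right, hence the left action
in terms of composition of maps.) -/
noncomputable def InducedModule.act {p : ℕ} (s : MonoidAlgebra ℝ (Equiv.Perm (Fin (p + 2))))
    (a : InducedModule p) : InducedModule p :=
  ∑ τ, s.coeff τ • Finsupp.mapDomain (fun c => τ • c) a

/-- `s` is a quasi-symmetry of an operator with leading coefficients `α_σ` if it annihilates the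
leading term, that is, its class in `E⁰(n)`. -/
def IsQuasiSymmetry {p : ℕ} (α : Equiv.Perm (Fin (p + 2)) → ℝ)
    (s : MonoidAlgebra ℝ (Equiv.Perm (Fin (p + 2)))) : Prop :=
  InducedModule.act s (leadingElement α) = 0

/-- `s = ∑ s_τ τ` is a symmetry of `D` if `D s = 0`, that is,
`∑ s_τ D(Γ, X_{τ(1)}, …, X_{τ(d)}) = 0` identically. -/
def NatOp.IsSymmetry {m d : ℕ} (D : NatOp.{u} m d)
    (s : MonoidAlgebra ℝ (Equiv.Perm (Fin d))) : Prop :=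
  ∀ (M : Type u) [TopologicalSpace M] [ChartedSpace (RealSpace m) M] [IsManifold (𝓡 m) ∞ M]
    [T2Space M] [SecondCountableTopology M] (Γ : SymConnection m M) (X : Fin d → SmoothVF m M),
    ∑ τ, s.coeff τ • D.op M Γ (fun i => X (τ i)) = 0

/-!
The covariant derivatives `∇^{p-1} R` of the curvature are natural operators in `p + 2` vector
fields. Up to derivatives of the Christoffel symbols of order `< p`, their components are
`∂_{1…(p-1)} (∂_a Γ^l_{bc} - ∂_b Γ^l_{ac})`. Writing `M_σ` for the leading monomial of a permutation
`σ`, the leading term is therefore `M_1 - M_t`, where `t` is the transposition of the last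
derivative index and the first lower index of `Γ`. As partial derivatives commute and `Γ` is
symmetric, `M_σ = M_{σh}` for `h` in the Young subgroup. The transposition `t` and the adjacent
transpositions in the Young subgroup generate the symmetric group, hence every combination of the
`M_σ` whose coefficients have sum zero is the leading term of a natural operator
(`mem_realizableCoeffs_of_sum_eq_zero`).

In particular there is an operator with leading term `M_1 - c ∑_σ M_σ`, `c = 1 / n!`. Averaging it
over the Young subgroup does not change the leading term and gives an operator `B` such that
`B(X_{σ(1)}, …, X_{σ(n)})` depends only on the coset of `σ` (`exists_youngInvariant_op`). Now let
`J = ∑_σ α_σ B(X_{σ(1)}, …, X_{σ(n)})`. The multiples of `∑_σ M_σ` cancel because `∑ α_σ = 0`, so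
the leading term of `J` is the required one. Moreover `J` is the image of the element
`∑ α_σ [σ]` of the induced module under an equivariant linear map, whence everything that
annihilates this element annihilates `J`.

That the operators are natural is seen from the coordinate formula for `∇_X Y` (`vfCoord_nabla`)
and from the resulting formula for the components of the covariant derivative of a tensor
(`vfCoord_covDerivOp`); derivatives of polynomials in the jets of `Γ` are computed by the
derivation `totalDeriv`.
-/

/-! ### Iterated partial derivatives -/

section PartialDerivatives

variable {m : ℕ} {f g : RealSpace m → ℝ} {U : Set (RealSpace m)}

@[simp]
theorem partialDeriv_zero (f : RealSpace m → ℝ) (ρ : Fin 0 → Fin m) (y : RealSpace m) :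
    partialDeriv f ρ y = f y := by
  simp [partialDeriv]

theorem partialDeriv_contDiffOn (hU : IsOpen U) (hf : ContDiffOn ℝ ∞ f U) {k : ℕ}
    (ρ : Fin k → Fin m) : ContDiffOn ℝ ∞ (partialDeriv f ρ) U := by
  intro y hy
  have h : ContDiffAt ℝ ∞ (iteratedFDeriv ℝ k f) y :=
    (hf.contDiffAt (hU.mem_nhds hy)).iteratedFDeriv_right (m := ∞) (i := k) (by
      exact_mod_cast le_top)
  exact ((ContinuousMultilinearMap.apply ℝ (fun _ : Fin k => RealSpace m) ℝ
    (fun i => basisVec m (ρ i))).contDiff.contDiffAt.comp y h).contDiffWithinAt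

theorem partialDeriv_differentiableAt (hU : IsOpen U) (hf : ContDiffOn ℝ ∞ f U) {k : ℕ}
    (ρ : Fin k → Fin m) {y : RealSpace m} (hy : y ∈ U) :
    DifferentiableAt ℝ (partialDeriv f ρ) y :=
  ((partialDeriv_contDiffOn hU hf ρ).contDiffAt (hU.mem_nhds hy)).differentiableAt (by simp)

theorem fderiv_partialDeriv (hU : IsOpen U) (hf : ContDiffOn ℝ ∞ f U) {k : ℕ}
    (ρ : Fin k → Fin m) (a : Fin m) {y : RealSpace m} (hy : y ∈ U) :
    fderiv ℝ (partialDeriv f ρ) y (basisVec m a) =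
      partialDeriv f (Fin.cons a ρ : Fin (k + 1) → Fin m) y := by
  have h : DifferentiableAt ℝ (iteratedFDeriv ℝ k f) y :=
    ((hf.contDiffAt (hU.mem_nhds hy)).iteratedFDeriv_right (m := ∞) (i := k) (by
      exact_mod_cast le_top)).differentiableAt (by simp)
  have h2 := ((ContinuousMultilinearMap.apply ℝ (fun _ : Fin k => RealSpace m) ℝ
    (fun i => basisVec m (ρ i))).hasFDerivAt.comp y h.hasFDerivAt).fderiv
  have h3 : partialDeriv f ρ = (ContinuousMultilinearMap.apply ℝ (fun _ : Fin k => RealSpace m) ℝ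
    (fun i => basisVec m (ρ i))) ∘ iteratedFDeriv ℝ k f := rfl
  rw [h3, h2, partialDeriv, iteratedFDeriv_succ_apply_left]
  rfl

theorem partialDeriv_congr (hU : IsOpen U) (h : Set.EqOn f g U) {k : ℕ} (ρ : Fin k → Fin m) :
    Set.EqOn (partialDeriv f ρ) (partialDeriv g ρ) U := by
  intro y hy
  rw [partialDeriv, partialDeriv,
    (Filter.EventuallyEq.iteratedFDeriv ℝ (h.eventuallyEq_of_mem (hU.mem_nhds hy)) k).eq_of_nhds]

/-- The order of the two outermost differentiations may be exchanged. -/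
theorem partialDeriv_cons_cons (hU : IsOpen U) (hf : ContDiffOn ℝ ∞ f U) {k : ℕ}
    (ρ : Fin k → Fin m) (a b : Fin m) {y : RealSpace m} (hy : y ∈ U) :
    partialDeriv f (Fin.cons a (Fin.cons b ρ : Fin (k + 1) → Fin m) : Fin (k + 2) → Fin m) y =
      partialDeriv f (Fin.cons b (Fin.cons a ρ : Fin (k + 1) → Fin m) : Fin (k + 2) → Fin m) y := by
  set g := partialDeriv f ρ with hg
  have hgs : ContDiffAt ℝ ∞ g y := (partialDeriv_contDiffOn hU hf ρ).contDiffAt (hU.mem_nhds hy)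
  have key : ∀ a b : Fin m,
      partialDeriv f (Fin.cons a (Fin.cons b ρ : Fin (k + 1) → Fin m) : Fin (k + 2) → Fin m) y =
        fderiv ℝ (fderiv ℝ g) y (basisVec m a) (basisVec m b) := by
    intro a b
    rw [← fderiv_partialDeriv hU hf _ a hy]
    have e : partialDeriv f (Fin.cons b ρ : Fin (k + 1) → Fin m) =ᶠ[nhds y]
        fun z => fderiv ℝ g z (basisVec m b) := by
      filter_upwards [hU.mem_nhds hy] with z hz
      rw [hg, fderiv_partialDeriv hU hf ρ b hz]
    have hd : DifferentiableAt ℝ (fderiv ℝ g) y :=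
      (hgs.fderiv_right (m := ∞) (by simp)).differentiableAt (by simp)
    rw [e.fderiv_eq, fderiv_clm_apply hd (differentiableAt_const _)]
    simp
  rw [key, key]
  exact hgs.isSymmSndFDerivAt (by
    rw [minSmoothness_of_isRCLikeNormedField]; exact WithTop.coe_le_coe.2 le_top) _ _

theorem partialDeriv_comp_adjacent_swap (hU : IsOpen U) (hf : ContDiffOn ℝ ∞ f U) {k : ℕ}
    (ρ : Fin (k + 1) → Fin m) (i : Fin k) {y : RealSpace m} (hy : y ∈ U) :
    partialDeriv f (ρ ∘ Equiv.swap i.castSucc i.succ) y = partialDeriv f ρ y := by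
  induction k generalizing y with
  | zero => exact i.elim0
  | succ k ih =>
    refine Fin.cases ?_ (fun j => ?_) i
    · have h1 : ρ = Fin.cons (ρ 0) (Fin.cons (ρ 1) (fun i : Fin k => ρ i.succ.succ) :
          Fin (k + 1) → Fin m) := by
        funext i
        refine Fin.cases rfl (fun i => Fin.cases rfl (fun i => rfl) i) i
      have h2 : ρ ∘ Equiv.swap (0 : Fin (k + 1)).castSucc (0 : Fin (k + 1)).succ =
          Fin.cons (ρ 1) (Fin.cons (ρ 0) (fun i : Fin k => ρ i.succ.succ) :
          Fin (k + 1) → Fin m) := by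
        funext i
        refine Fin.cases ?_ (fun i => Fin.cases ?_ (fun i => ?_) i) i
        · simp
        · simp
        · simp only [Function.comp_apply, Fin.cons_succ]
          rw [Equiv.swap_apply_of_ne_of_ne]
          · simp [Fin.ext_iff]
          · simp [Fin.ext_iff]
      rw [h2, partialDeriv_cons_cons hU hf _ _ _ hy, ← h1]
    · have h1 : ρ = (Fin.cons (ρ 0) (Fin.tail ρ) : Fin (k + 2) → Fin m) :=
        (Fin.cons_self_tail ρ).symm
      have h2 : ρ ∘ Equiv.swap j.succ.castSucc j.succ.succ =
          (Fin.cons (ρ 0) (Fin.tail ρ ∘ Equiv.swap j.castSucc j.succ) : Fin (k + 2) → Fin m) := by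
        funext i
        refine Fin.cases ?_ (fun i => ?_) i
        · simp only [Function.comp_apply, Fin.cons_zero]
          rw [Equiv.swap_apply_of_ne_of_ne]
          · simp [Fin.ext_iff]
          · simp [Fin.ext_iff]
        · simp only [Function.comp_apply, Fin.cons_succ, Fin.tail, Fin.castSucc_succ]
          rw [(Fin.succ_injective (k + 1)).swap_apply]
      rw [h2]
      conv_rhs => rw [h1]
      rw [← fderiv_partialDeriv hU hf _ _ hy, ← fderiv_partialDeriv hU hf _ _ hy]
      congr 1
      apply Filter.EventuallyEq.fderiv_eq
      filter_upwards [hU.mem_nhds hy] with z hz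
      exact ih _ _ hz

/-- Partial derivatives of a smooth function commute. -/
theorem partialDeriv_comp_perm (hU : IsOpen U) (hf : ContDiffOn ℝ ∞ f U) {k : ℕ}
    (ρ : Fin k → Fin m) (σ : Equiv.Perm (Fin k)) {y : RealSpace m} (hy : y ∈ U) :
    partialDeriv f (ρ ∘ σ) y = partialDeriv f ρ y := by
  cases k with
  | zero => rw [Subsingleton.elim (ρ ∘ σ) ρ]
  | succ k =>
    have hσ : σ ∈ Submonoid.closure
        (Set.range fun i : Fin k => Equiv.swap i.castSucc i.succ) := by
      rw [Equiv.Perm.mclosure_swap_castSucc_succ]; trivial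
    induction hσ using Submonoid.closure_induction generalizing ρ with
    | mem x hx =>
      obtain ⟨i, rfl⟩ := hx
      exact partialDeriv_comp_adjacent_swap hU hf ρ i hy
    | one => rfl
    | mul a b _ _ ha hb =>
      rw [Equiv.Perm.coe_mul, ← Function.comp_assoc, hb, ha]

/-- The derivative in a direction is the combination of the partial derivatives. -/
theorem fderiv_apply_eq_sum (f : RealSpace m → ℝ) (y v : RealSpace m) :
    fderiv ℝ f y v = ∑ a, v a * fderiv ℝ f y (basisVec m a) := by
  have hv : v = ∑ a, v a • basisVec m a := by
    ext i
    simp [basisVec, Pi.single_apply]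
  conv_lhs => rw [hv]
  simp

end PartialDerivatives

/-! ### Connections and vector fields in a chart -/

section Charts

variable {m : ℕ} {M : Type*} [TopologicalSpace M] [ChartedSpace (RealSpace m) M]
  {e : OpenPartialHomeomorph M (RealSpace m)}

theorem mdifferentiable_of_mem_maximalAtlas (he : e ∈ IsManifold.maximalAtlas (𝓡 m) ∞ M) :
    e.MDifferentiable (𝓡 m) (𝓡 m) :=
  ⟨fun _ hx => ((contMDiffAt_of_mem_maximalAtlas he hx).mdifferentiableAt
      (by simp)).mdifferentiableWithinAt,
    fun _ hx => ((contMDiffAt_symm_of_mem_maximalAtlas he hx).mdifferentiableAt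
      (by simp)).mdifferentiableWithinAt⟩

theorem mfderiv_inverse (he : e ∈ IsManifold.maximalAtlas (𝓡 m) ∞ M) {x : M}
    (hx : x ∈ e.source) :
    (mfderiv (𝓡 m) (𝓡 m) e x).inverse = mfderiv (𝓡 m) (𝓡 m) e.symm (e x) :=
  ContinuousLinearMap.inverse_eq
    (by
      have h := (mdifferentiable_of_mem_maximalAtlas he).comp_symm_deriv (e.map_source hx)
      rw [e.left_inv hx] at h
      exact h)
    ((mdifferentiable_of_mem_maximalAtlas he).symm_comp_deriv hx)

theorem mfderiv_symm_inverse (he : e ∈ IsManifold.maximalAtlas (𝓡 m) ∞ M) {y : RealSpace m}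
    (hy : y ∈ e.target) :
    (mfderiv (𝓡 m) (𝓡 m) e.symm y).inverse = mfderiv (𝓡 m) (𝓡 m) e (e.symm y) :=
  ContinuousLinearMap.inverse_eq
    (by
      have h := (mdifferentiable_of_mem_maximalAtlas he).symm_comp_deriv (e.map_target hy)
      rw [e.right_inv hy] at h
      exact h)
    ((mdifferentiable_of_mem_maximalAtlas he).comp_symm_deriv hy)

theorem isInvertible_mfderiv (he : e ∈ IsManifold.maximalAtlas (𝓡 m) ∞ M) {x : M}
    (hx : x ∈ e.source) : (mfderiv (𝓡 m) (𝓡 m) e x).IsInvertible :=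
  ⟨(mdifferentiable_of_mem_maximalAtlas he).mfderiv hx, rfl⟩

theorem isInvertible_mfderiv_symm (he : e ∈ IsManifold.maximalAtlas (𝓡 m) ∞ M) {y : RealSpace m}
    (hy : y ∈ e.target) : (mfderiv (𝓡 m) (𝓡 m) e.symm y).IsInvertible :=
  ⟨(mdifferentiable_of_mem_maximalAtlas he).symm.mfderiv hy, rfl⟩

theorem tangentCoord_coordField (he : e ∈ IsManifold.maximalAtlas (𝓡 m) ∞ M) {x : M}
    (hx : x ∈ e.source) (μ l : Fin m) :
    tangentCoord e x (coordField e μ x) l = if l = μ then 1 else 0 := by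
  have h := DFunLike.congr_fun ((mdifferentiable_of_mem_maximalAtlas he).comp_symm_deriv
    (e.map_source hx)) (basisVec m μ)
  rw [e.left_inv hx] at h
  have h2 : mfderiv (𝓡 m) (𝓡 m) e x (coordField e μ x) = basisVec m μ := by
    change mfderiv (𝓡 m) (𝓡 m) e x ((mfderiv (𝓡 m) (𝓡 m) e x).inverse (basisVec m μ)) = _
    rw [mfderiv_inverse he hx]
    exact h
  rw [tangentCoord, h2]
  simp [basisVec]

@[simp]
theorem tangentCoord_add (x : M) (v w : TangentSpace (𝓡 m) x) (l : Fin m) :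
    tangentCoord e x (v + w) l = tangentCoord e x v l + tangentCoord e x w l :=
  map_add ((EuclideanSpace.proj l : RealSpace m →L[ℝ] ℝ).comp
    (mfderiv (𝓡 m) (𝓡 m) e x : RealSpace m →L[ℝ] RealSpace m)) v w

@[simp]
theorem tangentCoord_sub (x : M) (v w : TangentSpace (𝓡 m) x) (l : Fin m) :
    tangentCoord e x (v - w) l = tangentCoord e x v l - tangentCoord e x w l :=
  map_sub ((EuclideanSpace.proj l : RealSpace m →L[ℝ] ℝ).comp
    (mfderiv (𝓡 m) (𝓡 m) e x : RealSpace m →L[ℝ] RealSpace m)) v w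

@[simp]
theorem tangentCoord_smul (x : M) (c : ℝ) (v : TangentSpace (𝓡 m) x) (l : Fin m) :
    tangentCoord e x (c • v) l = c * tangentCoord e x v l :=
  map_smul ((EuclideanSpace.proj l : RealSpace m →L[ℝ] ℝ).comp
    (mfderiv (𝓡 m) (𝓡 m) e x : RealSpace m →L[ℝ] RealSpace m)) c v

@[simp]
theorem tangentCoord_zero (x : M) (l : Fin m) :
    tangentCoord e x (0 : TangentSpace (𝓡 m) x) l = 0 :=
  map_zero ((EuclideanSpace.proj l : RealSpace m →L[ℝ] ℝ).comp
    (mfderiv (𝓡 m) (𝓡 m) e x : RealSpace m →L[ℝ] RealSpace m))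

@[simp]
theorem tangentCoord_sum {ι : Type*} (s : Finset ι) (x : M) (v : ι → TangentSpace (𝓡 m) x)
    (l : Fin m) : tangentCoord e x (∑ i ∈ s, v i) l = ∑ i ∈ s, tangentCoord e x (v i) l := by
  classical
  induction s using Finset.induction_on with
  | empty => simp
  | insert a s ha ih => simp [Finset.sum_insert ha, ih]

theorem tangentCoord_ext (he : e ∈ IsManifold.maximalAtlas (𝓡 m) ∞ M) {x : M}
    (hx : x ∈ e.source) {v w : TangentSpace (𝓡 m) x}
    (h : ∀ l, tangentCoord e x v l = tangentCoord e x w l) : v = w := by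
  apply (mdifferentiable_of_mem_maximalAtlas he).mfderiv_injective hx
  exact PiLp.ext (p := 2) (α := fun _ : Fin m => ℝ) h

theorem eq_sum_coordField (he : e ∈ IsManifold.maximalAtlas (𝓡 m) ∞ M) {x : M}
    (hx : x ∈ e.source) (v : TangentSpace (𝓡 m) x) :
    v = ∑ μ, tangentCoord e x v μ • coordField e μ x := by
  refine tangentCoord_ext he hx fun l => ?_
  simp [tangentCoord_coordField he hx]

variable [IsManifold (𝓡 m) ∞ M]

theorem contMDiffAt_coordField (he : e ∈ IsManifold.maximalAtlas (𝓡 m) ∞ M) {x : M}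
    (hx : x ∈ e.source) (μ : Fin m) :
    ContMDiffAt (𝓡 m) (𝓡 m).tangent ∞
      (fun x => (⟨x, coordField e μ x⟩ : TangentBundle (𝓡 m) M)) x := by
  have : IsManifold (𝓡 m) 1 M := IsManifold.of_le (n := ∞) (by simp)
  refine ContMDiffAt.mpullback_vectorField_preimage (n := ∞) ?_
    (contMDiffAt_of_mem_maximalAtlas he hx) (isInvertible_mfderiv he hx) (by simp)
  exact contMDiffAt_vectorSpace_iff_contDiffAt.2 contDiffAt_const

/-- The coefficients of a smooth vector field are smooth functions of the coordinates. -/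
theorem contDiffAt_tangentCoord (he : e ∈ IsManifold.maximalAtlas (𝓡 m) ∞ M) {y : RealSpace m}
    (hy : y ∈ e.target) {Y : (x : M) → TangentSpace (𝓡 m) x}
    (hY : ContMDiffAt (𝓡 m) (𝓡 m).tangent ∞
      (fun x => (⟨x, Y x⟩ : TangentBundle (𝓡 m) M)) (e.symm y)) (l : Fin m) :
    ContDiffAt ℝ ∞ (fun z => tangentCoord e (e.symm z) (Y (e.symm z)) l) y := by
  have : IsManifold (𝓡 m) 1 M := IsManifold.of_le (n := ∞) (by simp)
  have h := contMDiffAt_vectorSpace_iff_contDiffAt.1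
    (ContMDiffAt.mpullback_vectorField_preimage (n := ∞) hY
      (contMDiffAt_symm_of_mem_maximalAtlas he hy) (isInvertible_mfderiv_symm he hy) (by simp))
  refine ((EuclideanSpace.proj l : RealSpace m →L[ℝ] ℝ).contDiff.contDiffAt.comp y
    h).congr_of_eventuallyEq ?_
  filter_upwards [e.open_target.mem_nhds hy] with z hz
  change _ = (EuclideanSpace.proj l : RealSpace m →L[ℝ] ℝ)
    ((mfderiv (𝓡 m) (𝓡 m) e.symm z).inverse (Y (e.symm z)))
  rw [mfderiv_symm_inverse he hz]
  rfl

theorem contDiffOn_vfCoord (he : e ∈ IsManifold.maximalAtlas (𝓡 m) ∞ M) (X : SmoothVF m M)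
    (l : Fin m) : ContDiffOn ℝ ∞ (vfCoord e X l) e.target :=
  fun _ hy => (contDiffAt_tangentCoord he hy X.contMDiff.contMDiffAt l).contDiffWithinAt

/-- Near any point of its source, a coordinate vector field extends to a smooth global field. -/
theorem exists_contMDiff_eventuallyEq_coordField [T2Space M]
    (he : e ∈ IsManifold.maximalAtlas (𝓡 m) ∞ M) {x : M} (hx : x ∈ e.source) (μ : Fin m) :
    ∃ s : (x : M) → TangentSpace (𝓡 m) x,
      ContMDiff (𝓡 m) (𝓡 m).tangent ∞ (fun x => (⟨x, s x⟩ : TangentBundle (𝓡 m) M)) ∧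
      ∀ᶠ z in nhds x, s z = coordField e μ z := by
  obtain ⟨f, -, hf⟩ := (SmoothBumpFunction.nhds_basis_tsupport (I := 𝓡 m) x).mem_iff.1
    (e.open_source.mem_nhds hx)
  refine ⟨fun z => f z • coordField e μ z, ?_, ?_⟩
  · exact ContMDiffOn.smul_section_of_tsupport f.contMDiff.contMDiffOn e.open_source hf
      (fun z hz => (contMDiffAt_coordField he hz μ).contMDiffWithinAt)
  · filter_upwards [f.eventuallyEq_one] with z hz
    simp [hz]

theorem contMDiffAt_cov_apply (Γ : SymConnection m M) {s X : (x : M) → TangentSpace (𝓡 m) x}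
    (hs : ContMDiff (𝓡 m) (𝓡 m).tangent ∞ (fun x => (⟨x, s x⟩ : TangentBundle (𝓡 m) M)))
    {x : M} (hX : ContMDiffAt (𝓡 m) (𝓡 m).tangent ∞
      (fun x => (⟨x, X x⟩ : TangentBundle (𝓡 m) M)) x) :
    ContMDiffAt (𝓡 m) (𝓡 m).tangent ∞
      (fun x => (⟨x, Γ.cov s x (X x)⟩ : TangentBundle (𝓡 m) M)) x :=
  ContMDiffAt.clm_bundle_apply
    ((Γ.smooth.contMDiff.contMDiff (σ := s) (by simpa using hs.contMDiffOn)).contMDiffAt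
      Filter.univ_mem) hX

theorem contDiffOn_christoffel [T2Space M] (he : e ∈ IsManifold.maximalAtlas (𝓡 m) ∞ M)
    (Γ : SymConnection m M) (l μ ν : Fin m) :
    ContDiffOn ℝ ∞ (christoffel e Γ l μ ν) e.target := by
  intro y hy
  obtain ⟨s, hs, hse⟩ := exists_contMDiff_eventuallyEq_coordField he (e.map_target hy) ν
  refine ContDiffAt.contDiffWithinAt ?_
  refine (contDiffAt_tangentCoord he hy (contMDiffAt_cov_apply Γ hs
    (contMDiffAt_coordField he (e.map_target hy) μ)) l).congr_of_eventuallyEq ?_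
  have hc : ContinuousAt e.symm y := e.symm.continuousAt hy
  filter_upwards [hc.eventually hse.eventually_nhds, e.open_target.mem_nhds hy] with z hz hzt
  rw [christoffel]
  congr 2
  refine Γ.cov.isCovariantDerivativeOnUniv.congr_of_eventuallyEq
    ((contMDiffAt_coordField he (e.map_target hzt) ν).mdifferentiableAt (by simp))
    (hs.contMDiffAt.mdifferentiableAt (by simp)) Filter.univ_mem ?_
  filter_upwards [hz] with w hw using hw.symm

theorem christoffel_symm (he : e ∈ IsManifold.maximalAtlas (𝓡 m) ∞ M)
    (Γ : SymConnection m M) (l μ ν : Fin m) {y : RealSpace m} (hy : y ∈ e.target) :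
    christoffel e Γ l μ ν y = christoffel e Γ l ν μ y := by
  have hx := e.map_target hy
  have : IsManifold (𝓡 m) 2 M := IsManifold.of_le (n := ∞) (WithTop.coe_le_coe.2 le_top)
  have : IsManifold (𝓡 m) (minSmoothness ℝ 2) M := by
    rwa [minSmoothness_of_isRCLikeNormedField]
  have hd : ∀ μ, MDifferentiableAt (𝓡 m) (𝓡 m).tangent
      (fun x => (⟨x, coordField e μ x⟩ : TangentBundle (𝓡 m) M)) (e.symm y) :=
    fun μ => (contMDiffAt_coordField he hx μ).mdifferentiableAt (by simp)
  have h := Γ.cov.torsion_eq_zero_iff.1 Γ.torsion_eq_zero (hd μ) (hd ν)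
  have hc : ∀ μ, MDifferentiableAt (𝓡 m) (𝓡 m).tangent
      (fun x => (⟨x, basisVec m μ⟩ : TangentBundle (𝓡 m) (RealSpace m))) (e (e.symm y)) :=
    fun μ => (contMDiffAt_vectorSpace_iff_contDiffAt (n := 1).2
      contDiffAt_const).mdifferentiableAt (by simp)
  have hb := VectorField.mpullback_mlieBracket (f := e) (hc μ) (hc ν)
    (contMDiffAt_of_mem_maximalAtlas he hx)
    (by rw [minSmoothness_of_isRCLikeNormedField]; exact WithTop.coe_le_coe.2 le_top)
  have hz : VectorField.mlieBracket (𝓡 m) (M := RealSpace m) (fun _ => basisVec m μ)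
      (fun _ => basisVec m ν) = 0 := by
    ext1 z
    refine (congrFun (VectorField.mlieBracketWithin_univ (I := 𝓡 m) (M := RealSpace m)).symm
      z).trans ?_
    refine (congrFun VectorField.mlieBracketWithin_eq_lieBracketWithin z).trans ?_
    simp [VectorField.lieBracketWithin]
    rfl
  rw [hz, VectorField.mpullback_zero] at hb
  have h3 := h.trans hb.symm
  rw [christoffel, christoffel, sub_eq_zero.1 h3]

/-- The covariant derivative `∇_X Y` of a smooth vector field along another one. -/
noncomputable def SymConnection.nabla (Γ : SymConnection m M) (X Y : SmoothVF m M) :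
    SmoothVF m M :=
  ⟨fun x => Γ.cov Y x (X x), fun _ =>
    contMDiffAt_cov_apply Γ Y.contMDiff X.contMDiff.contMDiffAt⟩

theorem mdifferentiableAt_smoothVF (X : SmoothVF m M) (x : M) :
    MDifferentiableAt (𝓡 m) (𝓡 m).tangent
      (fun x => (⟨x, X x⟩ : TangentBundle (𝓡 m) M)) x :=
  X.contMDiff.contMDiffAt.mdifferentiableAt (by simp)

theorem SymConnection.nabla_add_left (Γ : SymConnection m M) (X X' Y : SmoothVF m M) :
    Γ.nabla (X + X') Y = Γ.nabla X Y + Γ.nabla X' Y := by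
  ext x
  exact map_add (Γ.cov Y x) (X x) (X' x)

theorem SymConnection.nabla_smul_left (Γ : SymConnection m M) (c : ℝ) (X Y : SmoothVF m M) :
    Γ.nabla (c • X) Y = c • Γ.nabla X Y := by
  ext x
  exact map_smul (Γ.cov Y x) c (X x)

theorem SymConnection.nabla_add_right (Γ : SymConnection m M) (X Y Y' : SmoothVF m M) :
    Γ.nabla X (Y + Y') = Γ.nabla X Y + Γ.nabla X Y' := by
  ext x
  exact DFunLike.congr_fun (Γ.cov.isCovariantDerivativeOnUniv.add
    (mdifferentiableAt_smoothVF Y x) (mdifferentiableAt_smoothVF Y' x)) (X x)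

theorem SymConnection.nabla_smul_right (Γ : SymConnection m M) (c : ℝ) (X Y : SmoothVF m M) :
    Γ.nabla X (c • Y) = c • Γ.nabla X Y := by
  ext x
  exact DFunLike.congr_fun (Γ.cov.isCovariantDerivativeOnUniv.smul_const c
    (mdifferentiableAt_smoothVF Y x)) (X x)

/-- The covariant derivative as a bilinear map on smooth vector fields. -/
noncomputable def SymConnection.nablaLin (Γ : SymConnection m M) :
    SmoothVF m M →ₗ[ℝ] SmoothVF m M →ₗ[ℝ] SmoothVF m M :=
  LinearMap.mk₂ ℝ Γ.nabla Γ.nabla_add_left Γ.nabla_smul_left Γ.nabla_add_right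
    Γ.nabla_smul_right

theorem SymConnection.cov_sum (Γ : SymConnection m M) {ι : Type*} (s : Finset ι)
    (σ : ι → (x : M) → TangentSpace (𝓡 m) x) {x : M}
    (hσ : ∀ i ∈ s, ContMDiffAt (𝓡 m) (𝓡 m).tangent ∞
      (fun x => (⟨x, σ i x⟩ : TangentBundle (𝓡 m) M)) x) :
    Γ.cov (fun z => ∑ i ∈ s, σ i z) x = ∑ i ∈ s, Γ.cov (σ i) x := by
  classical
  induction s using Finset.induction_on with
  | empty =>
    simp only [Finset.sum_empty]
    exact congrFun Γ.cov.zero x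
  | insert a s ha ih =>
    have h1 := hσ a (Finset.mem_insert_self a s)
    have h2 := fun i hi => hσ i (Finset.mem_insert_of_mem hi)
    have h3 : ContMDiffAt (𝓡 m) (𝓡 m).tangent ∞
        (fun x => (⟨x, ∑ i ∈ s, σ i x⟩ : TangentBundle (𝓡 m) M)) x :=
      ContMDiffAt.sum_section h2
    have h4 := Γ.cov.isCovariantDerivativeOnUniv.add
      (h1.mdifferentiableAt (by simp)) (h3.mdifferentiableAt (by simp))
    rw [Finset.sum_insert ha, ← ih h2, ← h4]
    congr 1
    ext1 z
    exact Finset.sum_insert ha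

/-- The coordinate formula `(∇_X Y)^l = X^μ (∂_μ Y^l + Γ^l_{μν} Y^ν)`. -/
theorem vfCoord_nabla (he : e ∈ IsManifold.maximalAtlas (𝓡 m) ∞ M) (Γ : SymConnection m M)
    (X Y : SmoothVF m M) (l : Fin m) {y : RealSpace m} (hy : y ∈ e.target) :
    vfCoord e (Γ.nabla X Y) l y = ∑ μ, vfCoord e X μ y *
      (fderiv ℝ (vfCoord e Y l) y (basisVec m μ) +
        ∑ ν, christoffel e Γ l μ ν y * vfCoord e Y ν y) := by
  set x := e.symm y with hxdef
  have hx : x ∈ e.source := e.map_target hy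
  have hex : e x = y := e.right_inv hy
  let g : Fin m → M → ℝ := fun ν z => vfCoord e Y ν (e z)
  have hdY : ∀ ν, DifferentiableAt ℝ (vfCoord e Y ν) (e x) := fun ν => by
    rw [hex]
    exact ((contDiffOn_vfCoord he Y ν).contDiffAt (e.open_target.mem_nhds hy)).differentiableAt
      (by simp)
  have hgs : ∀ ν, ContMDiffAt (𝓡 m) 𝓘(ℝ, ℝ) ∞ (g ν) x := fun ν => by
    have h1 : ContMDiffAt (𝓡 m) 𝓘(ℝ, ℝ) ∞ (vfCoord e Y ν) (e x) := by
      rw [hex]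
      exact ((contDiffOn_vfCoord he Y ν).contDiffAt (e.open_target.mem_nhds hy)).contMDiffAt
    exact h1.comp x (contMDiffAt_of_mem_maximalAtlas he hx)
  have hYe : ∀ᶠ z in nhds x, Y z = ∑ ν, g ν z • coordField e ν z := by
    filter_upwards [e.open_source.mem_nhds hx] with z hz
    have h := eq_sum_coordField he hz (Y z)
    have hg : ∀ ν, g ν z = tangentCoord e z (Y z) ν := fun ν => by
      simp only [g, vfCoord]
      rw [e.left_inv hz]
    simpa only [hg] using h
  have hterm : ∀ ν, ContMDiffAt (𝓡 m) (𝓡 m).tangent ∞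
      (fun x => (⟨x, g ν x • coordField e ν x⟩ : TangentBundle (𝓡 m) M)) x :=
    fun ν => (hgs ν).smul_section (contMDiffAt_coordField he hx ν)
  have hsum : ContMDiffAt (𝓡 m) (𝓡 m).tangent ∞
      (fun x => (⟨x, ∑ ν, g ν x • coordField e ν x⟩ : TangentBundle (𝓡 m) M)) x :=
    ContMDiffAt.sum_section fun ν _ => hterm ν
  have hcov : Γ.cov Y x = ∑ ν, (g ν x • Γ.cov (coordField e ν) x +
      (mvfderiv (𝓡 m) (g ν) x).smulRight (coordField e ν x)) := by
    rw [Γ.cov.isCovariantDerivativeOnUniv.congr_of_eventuallyEq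
      (mdifferentiableAt_smoothVF Y x) (hsum.mdifferentiableAt (by simp)) Filter.univ_mem hYe,
      Γ.cov_sum Finset.univ _ fun ν _ => hterm ν]
    refine Finset.sum_congr rfl fun ν _ => ?_
    exact Γ.cov.isCovariantDerivativeOnUniv.leibniz
      ((contMDiffAt_coordField he hx ν).mdifferentiableAt (by simp))
      ((hgs ν).mdifferentiableAt (by simp))
  have hdg : ∀ ν, mvfderiv (𝓡 m) (g ν) x (X x) =
      ∑ μ, vfCoord e X μ y * fderiv ℝ (vfCoord e Y ν) y (basisVec m μ) := fun ν => by
    have h1 : mfderiv (𝓡 m) 𝓘(ℝ, ℝ) (g ν) x =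
        (mfderiv (𝓡 m) 𝓘(ℝ, ℝ) (vfCoord e Y ν) (e x)).comp (mfderiv (𝓡 m) (𝓡 m) e x) :=
      mfderiv_comp x (hdY ν).mdifferentiableAt
        ((mdifferentiable_of_mem_maximalAtlas he).mdifferentiableAt hx)
    have h2 : mvfderiv (𝓡 m) (g ν) x (X x) =
        fderiv ℝ (vfCoord e Y ν) (e x) (mfderiv (𝓡 m) (𝓡 m) e x (X x)) := by
      rw [← mfderiv_eq_fderiv]
      exact DFunLike.congr_fun h1 (X x)
    refine (h2.trans (fderiv_apply_eq_sum _ _ _)).trans ?_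
    rw [hex]
    rfl
  have hXx := eq_sum_coordField he hx (X x)
  have hchr : ∀ ν, tangentCoord e x (Γ.cov (coordField e ν) x (X x)) l =
      ∑ μ, vfCoord e X μ y * christoffel e Γ l μ ν y := fun ν => by
    conv_lhs => rw [hXx]
    rw [map_sum, tangentCoord_sum]
    refine Finset.sum_congr rfl fun μ _ => ?_
    rw [map_smul, tangentCoord_smul]
    rfl
  have hgx : ∀ ν, g ν x = vfCoord e Y ν y := fun ν => by simp only [g, hex]
  have hL : vfCoord e (Γ.nabla X Y) l y = tangentCoord e x (Γ.cov Y x (X x)) l := rfl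
  have hval : Γ.cov Y x (X x) = ∑ ν, (g ν x • Γ.cov (coordField e ν) x (X x) +
      (mvfderiv (𝓡 m) (g ν) x (X x)) • (coordField e ν x)) := by
    rw [hcov, sum_apply]
    rfl
  rw [hL, hval, tangentCoord_sum]
  simp only [tangentCoord_add, tangentCoord_smul, tangentCoord_coordField he hx, hdg, hchr, hgx]
  rw [Finset.sum_add_distrib]
  simp only [mul_ite, mul_one, mul_zero, Finset.sum_ite_eq, Finset.mem_univ, if_true, mul_add,
    Finset.sum_add_distrib, Finset.mul_sum]
  rw [add_comm, Finset.sum_comm]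
  congr 1
  exact Finset.sum_congr rfl fun μ _ => Finset.sum_congr rfl fun ν _ => by ring

end Charts

/-! ### Covariant derivatives of multilinear operators -/

section CovariantDerivativeOfOperators

variable {V : Type*} [AddCommGroup V] [Module ℝ V]

theorem compLinearMap_update_id_apply {d : ℕ} (S : MultilinearMap ℝ (fun _ : Fin d => V) V)
    (i : Fin d) (A : V →ₗ[ℝ] V) (X : Fin d → V) :
    S.compLinearMap (Function.update (fun _ => LinearMap.id) i A) X =
      S (Function.update X i (A (X i))) := by
  rw [MultilinearMap.compLinearMap_apply]
  congr 1
  funext j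
  by_cases h : j = i
  · subst h
    simp
  · simp [h]

/-- The covariant derivative of a multilinear operator `S`, for a bilinear map `N X Y = ∇_X Y`:
`(∇_{X₀} S)(X₁, …, X_d) = ∇_{X₀} (S (X₁, …, X_d)) - ∑ i, S (X₁, …, ∇_{X₀} X_i, …, X_d)`. -/
noncomputable def covDerivOp (N : V →ₗ[ℝ] V →ₗ[ℝ] V) {d : ℕ}
    (S : MultilinearMap ℝ (fun _ : Fin d => V) V) :
    MultilinearMap ℝ (fun _ : Fin (d + 1) => V) V :=
  LinearMap.uncurryLeft
    { toFun := fun v => (N v).compMultilinearMap S -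
        ∑ i, S.compLinearMap (Function.update (fun _ => LinearMap.id) i (N v))
      map_add' := fun v w => by
        ext X
        simp only [map_add, add_apply, sub_apply, LinearMap.compMultilinearMap_apply, sum_apply,
          compLinearMap_update_id_apply, LinearMap.add_apply, MultilinearMap.map_update_add,
          Finset.sum_add_distrib]
        abel
      map_smul' := fun c v => by
        ext X
        simp only [map_smul, smul_apply, sub_apply, LinearMap.compMultilinearMap_apply, sum_apply,
          compLinearMap_update_id_apply, LinearMap.smul_apply, MultilinearMap.map_update_smul,
          ← Finset.smul_sum, smul_sub, RingHom.id_apply] }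

theorem covDerivOp_apply (N : V →ₗ[ℝ] V →ₗ[ℝ] V) {d : ℕ}
    (S : MultilinearMap ℝ (fun _ : Fin d => V) V) (X : Fin (d + 1) → V) :
    covDerivOp N S X = N (X 0) (S (Fin.tail X)) -
      ∑ i, S (Function.update (Fin.tail X) i (N (X 0) (X i.succ))) := by
  simp only [covDerivOp, LinearMap.uncurryLeft_apply, LinearMap.coe_mk, AddHom.coe_mk,
    sub_apply, LinearMap.compMultilinearMap_apply, sum_apply, compLinearMap_update_id_apply]
  rfl

theorem sum_fin_succ_fun {α β : Type*} [Fintype α] [AddCommMonoid β] {d : ℕ}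
    (F : (Fin (d + 1) → α) → β) : ∑ ρ, F ρ = ∑ a, ∑ ρ : Fin d → α, F (Fin.cons a ρ) := by
  rw [← (Fin.consEquiv (fun _ : Fin (d + 1) => α)).sum_comp, Fintype.sum_prod_type]
  rfl

/-- Exchange of the `i`-th index of a multi-index with a further summation index. -/
theorem sum_update_exchange {ι α β : Type*} [Fintype ι] [DecidableEq ι] [Fintype α]
    [AddCommMonoid β] (i : ι) (F : (ι → α) → α → β) :
    ∑ ρ, ∑ ν, F ρ ν = ∑ ρ, ∑ ν, F (Function.update ρ i ν) (ρ i) := by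
  have hinv : Function.Involutive
      (fun q : (ι → α) × α => (Function.update q.1 i q.2, q.1 i)) := by
    rintro ⟨ρ, ν⟩
    simp
  have h := Equiv.sum_comp (hinv.toPerm _) (fun q : (ι → α) × α => F q.1 q.2)
  rw [Fintype.sum_prod_type, Fintype.sum_prod_type] at h
  exact h.symm

/-- The algebra behind the components of the covariant derivative of a tensor: the derivatives
`dx` of the arguments cancel. -/
theorem covDeriv_components_identity {m d : ℕ} (x₀ : Fin m → ℝ) (x : Fin d → Fin m → ℝ)
    (dx : Fin d → Fin m → Fin m → ℝ) (G : Fin m → Fin m → Fin m → ℝ)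
    (t : Fin m → (Fin d → Fin m) → ℝ) (dt : (Fin d → Fin m) → Fin m → ℝ) (l : Fin m) :
    ∑ a, x₀ a * (∑ ρ : Fin d → Fin m,
        ((∑ i, (∏ j ∈ Finset.univ.erase i, x j (ρ j)) * dx i (ρ i) a) * t l ρ +
          (∏ j, x j (ρ j)) * dt ρ a) +
        ∑ ν, G l a ν * ∑ ρ, (∏ j, x j (ρ j)) * t ν ρ) -
      ∑ i, ∑ ρ : Fin d → Fin m, ((∏ j ∈ Finset.univ.erase i, x j (ρ j)) *
        ∑ a, x₀ a * (dx i (ρ i) a + ∑ ν, G (ρ i) a ν * x i ν)) * t l ρ =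
    ∑ a, ∑ ρ : Fin d → Fin m, (x₀ a * ∏ j, x j (ρ j)) *
      (dt ρ a + ∑ ν, G l a ν * t ν ρ -
        ∑ i, ∑ ν, t l (Function.update ρ i ν) * G ν a (ρ i)) := by
  have h1 : ∀ i, ∑ ρ : Fin d → Fin m, ((∏ j ∈ Finset.univ.erase i, x j (ρ j)) *
        ∑ a, x₀ a * (dx i (ρ i) a + ∑ ν, G (ρ i) a ν * x i ν)) * t l ρ =
      ∑ a, x₀ a * (∑ ρ : Fin d → Fin m,
        ((∏ j ∈ Finset.univ.erase i, x j (ρ j)) * dx i (ρ i) a * t l ρ) +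
        ∑ ρ : Fin d → Fin m, ∑ ν, (∏ j, x j (ρ j)) *
          (t l (Function.update ρ i ν) * G ν a (ρ i))) := by
    intro i
    have h2 : ∀ a, ∑ ρ : Fin d → Fin m, ∑ ν, (∏ j, x j (ρ j)) *
          (t l (Function.update ρ i ν) * G ν a (ρ i)) =
        ∑ ρ : Fin d → Fin m, ∑ ν, (∏ j ∈ Finset.univ.erase i, x j (ρ j)) * x i ν *
          (t l ρ * G (ρ i) a ν) := by
      intro a
      rw [sum_update_exchange i (fun ρ ν => (∏ j ∈ Finset.univ.erase i, x j (ρ j)) * x i ν *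
          (t l ρ * G (ρ i) a ν))]
      refine Finset.sum_congr rfl fun ρ _ => Finset.sum_congr rfl fun ν _ => ?_
      rw [← Finset.prod_erase_mul Finset.univ _ (Finset.mem_univ i), Function.update_self]
      congr 2
      refine Finset.prod_congr rfl fun j hj => ?_
      rw [Function.update_of_ne (Finset.ne_of_mem_erase hj)]
    simp only [h2, ← Finset.sum_add_distrib, Finset.mul_sum, Finset.sum_mul]
    rw [Finset.sum_comm]
    refine Finset.sum_congr rfl fun a _ => Finset.sum_congr rfl fun ρ _ => ?_
    rw [mul_add, mul_add, mul_add, add_mul, Finset.mul_sum, Finset.mul_sum, Finset.mul_sum,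
      Finset.sum_mul]
    congr 1
    · ring
    · exact Finset.sum_congr rfl fun ν _ => by ring
  simp only [h1]
  rw [Finset.sum_comm, ← Finset.sum_sub_distrib]
  refine Finset.sum_congr rfl fun a _ => ?_
  simp only [← Finset.mul_sum, mul_assoc, ← mul_sub]
  congr 1
  have h3 : ∑ ν, G l a ν * ∑ ρ, (∏ j, x j (ρ j)) * t ν ρ =
      ∑ ρ, (∏ j, x j (ρ j)) * ∑ ν, G l a ν * t ν ρ := by
    simp only [Finset.mul_sum]
    rw [Finset.sum_comm]
    exact Finset.sum_congr rfl fun ρ _ => Finset.sum_congr rfl fun ν _ => by ring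
  have h4 : ∑ i, ∑ ρ : Fin d → Fin m, (∏ j ∈ Finset.univ.erase i, x j (ρ j)) *
      (dx i (ρ i) a * t l ρ) = ∑ ρ : Fin d → Fin m,
      (∑ i, (∏ j ∈ Finset.univ.erase i, x j (ρ j)) * dx i (ρ i) a) * t l ρ := by
    rw [Finset.sum_comm]
    simp only [Finset.sum_mul, mul_assoc]
  have h5 : ∑ i, ∑ ρ : Fin d → Fin m, (∏ j, x j (ρ j)) *
      ∑ ν, (t l (Function.update ρ i ν) * G ν a (ρ i)) = ∑ ρ : Fin d → Fin m,
      (∏ j, x j (ρ j)) * ∑ i, ∑ ν, (t l (Function.update ρ i ν) * G ν a (ρ i)) := by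
    rw [Finset.sum_comm]
    simp only [Finset.mul_sum]
  rw [h3, Finset.sum_add_distrib, Finset.sum_add_distrib, h4, h5]
  simp only [mul_add, mul_sub, Finset.sum_add_distrib, Finset.sum_sub_distrib]
  ring

end CovariantDerivativeOfOperators

section LocalComponents

variable {m : ℕ} {M : Type*} [TopologicalSpace M] [ChartedSpace (RealSpace m) M]
  [IsManifold (𝓡 m) ∞ M] {e : OpenPartialHomeomorph M (RealSpace m)}

theorem vfCoord_add (X Y : SmoothVF m M) (l : Fin m) (y : RealSpace m) :
    vfCoord e (X + Y) l y = vfCoord e X l y + vfCoord e Y l y :=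
  tangentCoord_add _ _ _ _

theorem vfCoord_sub (X Y : SmoothVF m M) (l : Fin m) (y : RealSpace m) :
    vfCoord e (X - Y) l y = vfCoord e X l y - vfCoord e Y l y :=
  tangentCoord_sub _ _ _ _

theorem vfCoord_smul (c : ℝ) (X : SmoothVF m M) (l : Fin m) (y : RealSpace m) :
    vfCoord e (c • X) l y = c * vfCoord e X l y :=
  tangentCoord_smul _ _ _ _

theorem vfCoord_zero (l : Fin m) (y : RealSpace m) :
    vfCoord e (0 : SmoothVF m M) l y = 0 :=
  tangentCoord_zero _ _

theorem vfCoord_sum {ι : Type*} (s : Finset ι) (X : ι → SmoothVF m M) (l : Fin m)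
    (y : RealSpace m) : vfCoord e (∑ i ∈ s, X i) l y = ∑ i ∈ s, vfCoord e (X i) l y := by
  classical
  induction s using Finset.induction_on with
  | empty => simp [vfCoord_zero]
  | insert a s ha ih => rw [Finset.sum_insert ha, Finset.sum_insert ha, vfCoord_add, ih]

theorem differentiableAt_vfCoord (he : e ∈ IsManifold.maximalAtlas (𝓡 m) ∞ M)
    (X : SmoothVF m M) (l : Fin m) {y : RealSpace m} (hy : y ∈ e.target) :
    DifferentiableAt ℝ (vfCoord e X l) y :=
  ((contDiffOn_vfCoord he X l).contDiffAt (e.open_target.mem_nhds hy)).differentiableAt (by simp)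

/-- The components of the covariant derivative of a tensor with components `t`. -/
theorem vfCoord_covDerivOp (he : e ∈ IsManifold.maximalAtlas (𝓡 m) ∞ M) (Γ : SymConnection m M)
    {d : ℕ} (S : MultilinearMap ℝ (fun _ : Fin d => SmoothVF m M) (SmoothVF m M))
    (t : Fin m → (Fin d → Fin m) → RealSpace m → ℝ)
    (hS : ∀ X l, ∀ z ∈ e.target, vfCoord e (S X) l z =
      ∑ ρ : Fin d → Fin m, (∏ i, vfCoord e (X i) (ρ i) z) * t l ρ z)
    (ht : ∀ l ρ, ∀ z ∈ e.target, DifferentiableAt ℝ (t l ρ) z)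
    (X : Fin (d + 1) → SmoothVF m M) (l : Fin m) {y : RealSpace m} (hy : y ∈ e.target) :
    vfCoord e (covDerivOp Γ.nablaLin S X) l y =
      ∑ ρ : Fin (d + 1) → Fin m, (∏ i, vfCoord e (X i) (ρ i) y) *
        (fderiv ℝ (t l (Fin.tail ρ)) y (basisVec m (ρ 0)) +
          ∑ ν, christoffel e Γ l (ρ 0) ν y * t ν (Fin.tail ρ) y -
          ∑ i, ∑ ν, t l (Function.update (Fin.tail ρ) i ν) y *
            christoffel e Γ ν (ρ 0) (Fin.tail ρ i) y) := by
  have hN : ∀ A B : SmoothVF m M, Γ.nablaLin A B = Γ.nabla A B := fun _ _ => rfl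
  have hfd : ∀ a, fderiv ℝ (vfCoord e (S (Fin.tail X)) l) y (basisVec m a) =
      ∑ ρ : Fin d → Fin m,
        ((∑ i, (∏ j ∈ Finset.univ.erase i, vfCoord e (X j.succ) (ρ j) y) *
            fderiv ℝ (vfCoord e (X i.succ) (ρ i)) y (basisVec m a)) * t l ρ y +
          (∏ j : Fin d, vfCoord e (X j.succ) (ρ j) y) *
            fderiv ℝ (t l ρ) y (basisVec m a)) := by
    intro a
    have heq : vfCoord e (S (Fin.tail X)) l =ᶠ[nhds y] fun z =>
        ∑ ρ : Fin d → Fin m, (∏ i : Fin d, vfCoord e (X i.succ) (ρ i) z) * t l ρ z := by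
      filter_upwards [e.open_target.mem_nhds hy] with z hz using hS _ l z hz
    have hd : HasFDerivAt (fun z =>
        ∑ ρ : Fin d → Fin m, (∏ i : Fin d, vfCoord e (X i.succ) (ρ i) z) * t l ρ z) _ y :=
      HasFDerivAt.fun_sum fun ρ _ => HasFDerivAt.mul
        (HasFDerivAt.finsetProd (u := Finset.univ) fun i _ =>
          (differentiableAt_vfCoord he (X i.succ) (ρ i) hy).hasFDerivAt)
        (ht l ρ y hy).hasFDerivAt
    rw [heq.fderiv_eq, hd.fderiv, sum_apply]
    refine Finset.sum_congr rfl fun ρ _ => ?_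
    simp only [add_apply, smul_apply, sum_apply,
      smul_eq_mul]
    ring
  have hupd : ∀ i : Fin d, vfCoord e (S (Function.update (Fin.tail X) i
      (Γ.nabla (X 0) (X i.succ)))) l y = ∑ ρ : Fin d → Fin m,
        ((∏ j ∈ Finset.univ.erase i, vfCoord e (X j.succ) (ρ j) y) *
        ∑ a, vfCoord e (X 0) a y * (fderiv ℝ (vfCoord e (X i.succ) (ρ i)) y (basisVec m a) +
          ∑ ν, christoffel e Γ (ρ i) a ν y * vfCoord e (X i.succ) ν y)) * t l ρ y := by
    intro i
    rw [hS _ l y hy]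
    refine Finset.sum_congr rfl fun ρ _ => ?_
    rw [← Finset.prod_erase_mul Finset.univ _ (Finset.mem_univ i), Function.update_self,
      vfCoord_nabla he Γ _ _ _ hy]
    congr 2
    refine Finset.prod_congr rfl fun j hj => ?_
    rw [Function.update_of_ne (Finset.ne_of_mem_erase hj)]
    rfl
  rw [covDerivOp_apply, vfCoord_sub, vfCoord_sum]
  simp only [hN, hupd]
  rw [vfCoord_nabla he Γ _ _ _ hy, sum_fin_succ_fun]
  simp only [hfd, hS _ _ y hy, Fin.prod_univ_succ, Fin.cons_zero, Fin.cons_succ, Fin.tail_cons]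
  exact covDeriv_components_identity (fun a => vfCoord e (X 0) a y)
    (fun i a => vfCoord e (X i.succ) a y)
    (fun i b a => fderiv ℝ (vfCoord e (X i.succ) b) y (basisVec m a))
    (fun l a ν => christoffel e Γ l a ν y) (fun l ρ => t l ρ y)
    (fun ρ a => fderiv ℝ (t l ρ) y (basisVec m a)) l

end LocalComponents

/-! ### Polynomials in the derivatives of the Christoffel symbols -/

section ConnectionPolynomials

/-- The total derivative in the direction `∂/∂x^a` of polynomials in the partial derivatives of
the Christoffel symbols. These are encoded as polynomials in the jet variables of a connection
and of no vector fields. -/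
noncomputable def totalDeriv {m : ℕ} (a : Fin m) :
    Derivation ℝ (MvPolynomial (JetVar m 0) ℝ) (MvPolynomial (JetVar m 0) ℝ) :=
  MvPolynomial.mkDerivation ℝ fun v => match v with
    | .conn k ρ l μ ν => MvPolynomial.X (.conn (k + 1) (Fin.cons a ρ) l μ ν)
    | .vf i _ _ _ => i.elim0

/-- The polynomials in the derivatives of order `< p` of the Christoffel symbols and in the
undifferentiated coefficients of the vector fields. -/
noncomputable def lowerOrder (m d p : ℕ) : Subalgebra ℝ (MvPolynomial (JetVar m d) ℝ) :=
  MvPolynomial.supported ℝ {v | v.IsLower p}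

theorem X_mem_lowerOrder {m d p : ℕ} {v : JetVar m d} (hv : v.IsLower p) :
    (MvPolynomial.X v : MvPolynomial (JetVar m d) ℝ) ∈ lowerOrder m d p :=
  Algebra.subset_adjoin ⟨v, hv, rfl⟩

theorem lowerOrder_mono (m d : ℕ) {p q : ℕ} (h : p ≤ q) : lowerOrder m d p ≤ lowerOrder m d q := by
  refine MvPolynomial.supported_mono ?_
  rintro (⟨k, ρ, l, μ, ν⟩ | ⟨i, k, ρ, l⟩) hv
  · exact lt_of_lt_of_le hv h
  · exact hv

theorem totalDeriv_mem_lowerOrder {m p : ℕ} (a : Fin m) {P : MvPolynomial (JetVar m 0) ℝ}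
    (hP : P ∈ lowerOrder m 0 p) : totalDeriv a P ∈ lowerOrder m 0 (p + 1) := by
  have hle := lowerOrder_mono m 0 (Nat.le_succ p)
  refine Algebra.adjoin_induction (p := fun P _ => totalDeriv a P ∈ lowerOrder m 0 (p + 1))
    ?_ ?_ ?_ ?_ hP
  · rintro _ ⟨v, hv, rfl⟩
    rw [totalDeriv, MvPolynomial.mkDerivation_X]
    rcases v with ⟨k, ρ, l, μ, ν⟩ | ⟨i, -, -, -⟩
    · exact X_mem_lowerOrder (Nat.succ_lt_succ hv)
    · exact i.elim0
  · intro r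
    rw [Derivation.map_algebraMap]
    exact Subalgebra.zero_mem _
  · intro P Q _ _ hP hQ
    rw [map_add]
    exact Subalgebra.add_mem _ hP hQ
  · intro P Q hP' hQ' hP hQ
    rw [Derivation.leibniz]
    exact Subalgebra.add_mem _ (Subalgebra.mul_mem _ (hle hP') hQ)
      (Subalgebra.mul_mem _ (hle hQ') hP)

variable {m : ℕ} {M : Type*} [TopologicalSpace M] [ChartedSpace (RealSpace m) M]
  [IsManifold (𝓡 m) ∞ M] {e : OpenPartialHomeomorph M (RealSpace m)}

/-- The value of a polynomial in the derivatives of the Christoffel symbols of `Γ`. -/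
noncomputable def connEval (e : OpenPartialHomeomorph M (RealSpace m)) (Γ : SymConnection m M)
    (P : MvPolynomial (JetVar m 0) ℝ) (y : RealSpace m) : ℝ :=
  MvPolynomial.eval (jetValue e Γ Fin.elim0 y) P

theorem differentiableAt_and_fderiv_connEval [T2Space M]
    (he : e ∈ IsManifold.maximalAtlas (𝓡 m) ∞ M)
    (Γ : SymConnection m M) (P : MvPolynomial (JetVar m 0) ℝ) {y : RealSpace m}
    (hy : y ∈ e.target) : DifferentiableAt ℝ (connEval e Γ P) y ∧
      ∀ a, fderiv ℝ (connEval e Γ P) y (basisVec m a) = connEval e Γ (totalDeriv a P) y := by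
  induction P using MvPolynomial.induction_on with
  | C r =>
    have h : connEval e Γ (MvPolynomial.C r) = fun _ => r := by
      funext z
      simp [connEval]
    rw [h]
    refine ⟨differentiableAt_const _, fun a => ?_⟩
    rw [← MvPolynomial.algebraMap_eq, Derivation.map_algebraMap]
    simp [connEval]
  | add P Q hP hQ =>
    have h : connEval e Γ (P + Q) = connEval e Γ P + connEval e Γ Q := by
      funext z
      simp [connEval]
    rw [h]
    refine ⟨hP.1.add hQ.1, fun a => ?_⟩
    rw [fderiv_add hP.1 hQ.1, map_add, add_apply, hP.2, hQ.2]
    simp [connEval]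
  | mul_X P v hP =>
    have h : connEval e Γ (P * MvPolynomial.X v) =
        connEval e Γ P * connEval e Γ (MvPolynomial.X v) := by
      funext z
      simp [connEval]
    have hX : DifferentiableAt ℝ (connEval e Γ (MvPolynomial.X v)) y ∧
        ∀ a, fderiv ℝ (connEval e Γ (MvPolynomial.X v)) y (basisVec m a) =
          connEval e Γ (totalDeriv a (MvPolynomial.X v)) y := by
      rcases v with ⟨k, ρ, l, μ, ν⟩ | ⟨i, -, -, -⟩
      · have h1 : connEval e Γ (MvPolynomial.X (.conn k ρ l μ ν)) =
            partialDeriv (christoffel e Γ l μ ν) ρ := by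
          funext z
          simp [connEval, jetValue]
        have hs := contDiffOn_christoffel he Γ l μ ν
        rw [h1]
        refine ⟨partialDeriv_differentiableAt e.open_target hs ρ hy, fun a => ?_⟩
        rw [fderiv_partialDeriv e.open_target hs ρ a hy, totalDeriv,
          MvPolynomial.mkDerivation_X]
        simp [connEval, jetValue]
      · exact i.elim0
    rw [h]
    refine ⟨hP.1.mul hX.1, fun a => ?_⟩
    rw [fderiv_mul hP.1 hX.1, Derivation.leibniz, add_apply, smul_apply, smul_apply, hP.2, hX.2]
    simp [connEval]

end ConnectionPolynomials

/-! ### The curvature and its covariant derivatives -/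

section Curvature

/-- `T` are the components of `O`: in every chart `O(Γ, X₁, …, X_d)^l` is the contraction of the
polynomials `T^l_{ρ₁ … ρ_d}` in the derivatives of the Christoffel symbols with the `X_i`. -/
def OpFamily.HasComponents {m d : ℕ} (O : OpFamily.{u} m d)
    (T : Fin m → (Fin d → Fin m) → MvPolynomial (JetVar m 0) ℝ) : Prop :=
  ∀ (M : Type u) [TopologicalSpace M] [ChartedSpace (RealSpace m) M] [IsManifold (𝓡 m) ∞ M]
    [T2Space M] [SecondCountableTopology M] (Γ : SymConnection m M) (X : Fin d → SmoothVF m M),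
    ∀ e ∈ IsManifold.maximalAtlas (𝓡 m) ∞ M, ∀ y ∈ e.target, ∀ l : Fin m,
      vfCoord e (O M Γ X) l y =
        ∑ ρ : Fin d → Fin m, (∏ i, vfCoord e (X i) (ρ i) y) * connEval e Γ (T l ρ) y

/-- The Christoffel symbol as a polynomial variable. -/
noncomputable def christoffelVar {m : ℕ} (l μ ν : Fin m) : MvPolynomial (JetVar m 0) ℝ :=
  MvPolynomial.X (.conn 0 Fin.elim0 l μ ν)

theorem connEval_christoffelVar {m : ℕ} {M : Type*} [TopologicalSpace M]
    [ChartedSpace (RealSpace m) M] [IsManifold (𝓡 m) ∞ M]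
    (e : OpenPartialHomeomorph M (RealSpace m)) (Γ : SymConnection m M) (l μ ν : Fin m)
    (y : RealSpace m) : connEval e Γ (christoffelVar l μ ν) y = christoffel e Γ l μ ν y := by
  simp [connEval, christoffelVar, jetValue]

/-- The covariant derivative of an operator; the new argument is the first one. -/
noncomputable def OpFamily.covDeriv {m d : ℕ} (O : OpFamily.{u} m d) : OpFamily.{u} m (d + 1) :=
  fun M _ _ _ _ _ Γ => covDerivOp Γ.nablaLin (O M Γ)

/-- The components `∇_{ρ₀} T^l_{ρ₁ … ρ_d}` of the covariant derivative. -/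
noncomputable def covDerivComponents {m d : ℕ}
    (T : Fin m → (Fin d → Fin m) → MvPolynomial (JetVar m 0) ℝ) (l : Fin m)
    (ρ : Fin (d + 1) → Fin m) : MvPolynomial (JetVar m 0) ℝ :=
  totalDeriv (ρ 0) (T l (Fin.tail ρ)) +
    ∑ ν, christoffelVar l (ρ 0) ν * T ν (Fin.tail ρ) -
    ∑ i, ∑ ν, T l (Function.update (Fin.tail ρ) i ν) * christoffelVar ν (ρ 0) (Fin.tail ρ i)

theorem OpFamily.HasComponents.covDeriv {m d : ℕ} {O : OpFamily.{u} m d}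
    {T : Fin m → (Fin d → Fin m) → MvPolynomial (JetVar m 0) ℝ} (h : O.HasComponents T) :
    O.covDeriv.HasComponents (covDerivComponents T) := by
  intro M _ _ _ _ _ Γ X e he y hy l
  refine (vfCoord_covDerivOp he Γ (O M Γ) (fun l ρ => connEval e Γ (T l ρ))
    (fun X l z hz => h M Γ X e he z hz l)
    (fun l ρ z hz => (differentiableAt_and_fderiv_connEval he Γ (T l ρ) hz).1) X l hy).trans ?_
  refine Finset.sum_congr rfl fun ρ _ => ?_
  congr 1
  rw [(differentiableAt_and_fderiv_connEval he Γ _ hy).2]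
  simp only [← connEval_christoffelVar]
  simp [covDerivComponents, connEval]

/-- The trilinear map `∇²_{X,Y} Z - ∇²_{Y,X} Z`, where
`∇²_{X,Y} Z = ∇_X (∇_Y Z) - ∇_{∇_X Y} Z`. -/
noncomputable def curvatureLin {V : Type*} [AddCommGroup V] [Module ℝ V]
    (N : V →ₗ[ℝ] V →ₗ[ℝ] V) : V →ₗ[ℝ] V →ₗ[ℝ] V →ₗ[ℝ] V :=
  ((LinearMap.mul ℝ (Module.End ℝ V)).compl₁₂ N N - N.compr₂ N) -
    ((LinearMap.mul ℝ (Module.End ℝ V)).compl₁₂ N N - N.compr₂ N).flip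

theorem curvatureLin_apply {V : Type*} [AddCommGroup V] [Module ℝ V]
    (N : V →ₗ[ℝ] V →ₗ[ℝ] V) (X Y Z : V) :
    curvatureLin N X Y Z = (N X (N Y Z) - N (N X Y) Z) - (N Y (N X Z) - N (N Y X) Z) := by
  simp [curvatureLin]

/-- A trilinear map, bundled as a multilinear map in three arguments. -/
noncomputable def trilinearOp {V : Type*} [AddCommGroup V] [Module ℝ V]
    (C : V →ₗ[ℝ] V →ₗ[ℝ] V →ₗ[ℝ] V) : MultilinearMap ℝ (fun _ : Fin 3 => V) V :=
  LinearMap.uncurryLeft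
    { toFun := fun x => LinearMap.uncurryLeft
        { toFun := fun y => LinearMap.uncurryLeft
            { toFun := fun z => MultilinearMap.constOfIsEmpty ℝ _ (C x y z)
              map_add' := fun _ _ => by ext; simp
              map_smul' := fun _ _ => by ext; simp }
          map_add' := fun _ _ => by ext; simp
          map_smul' := fun _ _ => by ext; simp }
      map_add' := fun _ _ => by ext; simp
      map_smul' := fun _ _ => by ext; simp }

/-- The curvature of a torsion-free connection, `R(X, Y) Z = ∇²_{X,Y} Z - ∇²_{Y,X} Z`. -/
noncomputable def curvatureOp (m : ℕ) : OpFamily.{u} m 3 := fun _ _ _ _ _ _ Γ =>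
  trilinearOp (curvatureLin Γ.nablaLin)

/-- The components of `∇²_{X,Y} Z`, in terms of the values and derivatives of the coefficients
of `Z` and of the Christoffel symbols. -/
theorem vfCoord_hessian {m : ℕ} {M : Type*} [TopologicalSpace M] [ChartedSpace (RealSpace m) M]
    [IsManifold (𝓡 m) ∞ M] [T2Space M] {e : OpenPartialHomeomorph M (RealSpace m)}
    (he : e ∈ IsManifold.maximalAtlas (𝓡 m) ∞ M) (Γ : SymConnection m M)
    (X Y Z : SmoothVF m M) (l : Fin m) {y : RealSpace m} (hy : y ∈ e.target) :
    vfCoord e (Γ.nabla X (Γ.nabla Y Z) - Γ.nabla (Γ.nabla X Y) Z) l y =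
      ∑ a, ∑ b, vfCoord e X a y * vfCoord e Y b y *
        ((partialDeriv (vfCoord e Z l) ![a, b] y +
          ∑ c, (partialDeriv (christoffel e Γ l b c) ![a] y * vfCoord e Z c y +
            christoffel e Γ l b c y * fderiv ℝ (vfCoord e Z c) y (basisVec m a))) +
        ∑ ν, christoffel e Γ l a ν y * (fderiv ℝ (vfCoord e Z ν) y (basisVec m b) +
          ∑ c, christoffel e Γ ν b c y * vfCoord e Z c y) -
        ∑ ν, christoffel e Γ ν a b y * (fderiv ℝ (vfCoord e Z l) y (basisVec m ν) +
          ∑ c, christoffel e Γ l ν c y * vfCoord e Z c y)) := by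
  set w : Fin m → Fin m → RealSpace m → ℝ := fun l b z =>
    fderiv ℝ (vfCoord e Z l) z (basisVec m b) +
      ∑ c, christoffel e Γ l b c z * vfCoord e Z c z with hw
  have hU := e.open_target
  have hG := contDiffOn_christoffel he Γ
  have hdG : ∀ l b c, DifferentiableAt ℝ (christoffel e Γ l b c) y := fun l b c =>
    ((hG l b c).contDiffAt (hU.mem_nhds hy)).differentiableAt (by simp)
  have hdZ := fun c => differentiableAt_vfCoord he Z c hy
  have hdw : ∀ l b a, HasFDerivAt (w l b) (fderiv ℝ (w l b) y) y ∧
      fderiv ℝ (w l b) y (basisVec m a) = partialDeriv (vfCoord e Z l) ![a, b] y +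
        ∑ c, (partialDeriv (christoffel e Γ l b c) ![a] y * vfCoord e Z c y +
          christoffel e Γ l b c y * fderiv ℝ (vfCoord e Z c) y (basisVec m a)) := by
    intro l b a
    have h1 : (fun z => fderiv ℝ (vfCoord e Z l) z (basisVec m b)) =ᶠ[nhds y]
        partialDeriv (vfCoord e Z l) ![b] := by
      filter_upwards [hU.mem_nhds hy] with z hz
      exact fderiv_partialDeriv hU (contDiffOn_vfCoord he Z l) Fin.elim0 b hz
    have h2 := ((partialDeriv_differentiableAt hU (contDiffOn_vfCoord he Z l) ![b]
      hy).hasFDerivAt.congr_of_eventuallyEq h1)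
    have h3 : HasFDerivAt (fun z => ∑ c, christoffel e Γ l b c z * vfCoord e Z c z) _ y :=
      HasFDerivAt.fun_sum fun c _ => (hdG l b c).hasFDerivAt.mul (hdZ c).hasFDerivAt
    have h4 : HasFDerivAt (w l b) _ y := h2.add h3
    refine ⟨h4.differentiableAt.hasFDerivAt, ?_⟩
    rw [h4.fderiv, add_apply, fderiv_partialDeriv hU (contDiffOn_vfCoord he Z l) _ a hy,
      sum_apply]
    congr 1
    refine Finset.sum_congr rfl fun c _ => ?_
    have h5 : fderiv ℝ (christoffel e Γ l b c) y (basisVec m a) =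
        partialDeriv (christoffel e Γ l b c) ![a] y :=
      fderiv_partialDeriv hU (hG l b c) Fin.elim0 a hy
    simp only [add_apply, smul_apply, smul_eq_mul, h5]
    ring
  have hYZ : ∀ l, ∀ z ∈ e.target, vfCoord e (Γ.nabla Y Z) l z =
      ∑ b, vfCoord e Y b z * w l b z := fun l z hz => vfCoord_nabla he Γ Y Z l hz
  have hfd : ∀ a, fderiv ℝ (vfCoord e (Γ.nabla Y Z) l) y (basisVec m a) =
      ∑ b, (fderiv ℝ (vfCoord e Y b) y (basisVec m a) * w l b y +
        vfCoord e Y b y * fderiv ℝ (w l b) y (basisVec m a)) := by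
    intro a
    have heq : vfCoord e (Γ.nabla Y Z) l =ᶠ[nhds y] fun z => ∑ b, vfCoord e Y b z * w l b z := by
      filter_upwards [hU.mem_nhds hy] with z hz using hYZ l z hz
    have hd : HasFDerivAt (fun z => ∑ b, vfCoord e Y b z * w l b z) _ y :=
      HasFDerivAt.fun_sum fun b _ =>
        (differentiableAt_vfCoord he Y b hy).hasFDerivAt.mul (hdw l b a).1
    rw [heq.fderiv_eq, hd.fderiv, sum_apply]
    refine Finset.sum_congr rfl fun b _ => ?_
    simp only [add_apply, smul_apply, smul_eq_mul]
    ring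
  have hXYZ : vfCoord e (Γ.nabla (Γ.nabla X Y) Z) l y =
      ∑ a, ∑ b, vfCoord e X a y * (fderiv ℝ (vfCoord e Y b) y (basisVec m a) * w l b y +
        vfCoord e Y b y * ∑ ν, christoffel e Γ ν a b y * w l ν y) := by
    rw [vfCoord_nabla he Γ _ _ _ hy]
    have h1 : ∀ b, vfCoord e (Γ.nabla X Y) b y * w l b y = ∑ a, vfCoord e X a y *
        (fderiv ℝ (vfCoord e Y b) y (basisVec m a) * w l b y +
          ∑ ν, vfCoord e Y ν y * (christoffel e Γ b a ν y * w l b y)) := by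
      intro b
      rw [vfCoord_nabla he Γ _ _ _ hy, Finset.sum_mul]
      refine Finset.sum_congr rfl fun a _ => ?_
      rw [mul_assoc, add_mul, Finset.sum_mul]
      congr 2
      exact Finset.sum_congr rfl fun ν _ => by ring
    change ∑ b, vfCoord e (Γ.nabla X Y) b y * w l b y = _
    simp only [h1]
    rw [Finset.sum_comm]
    refine Finset.sum_congr rfl fun a _ => ?_
    simp only [mul_add, Finset.sum_add_distrib, Finset.mul_sum]
    congr 1
    exact Finset.sum_comm
  rw [vfCoord_sub, vfCoord_nabla he Γ _ _ _ hy, hXYZ, ← Finset.sum_sub_distrib]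
  refine Finset.sum_congr rfl fun a _ => ?_
  rw [hfd, ← Finset.mul_sum, ← mul_sub]
  simp only [mul_assoc, ← Finset.mul_sum]
  congr 1
  have h2 : ∑ ν, christoffel e Γ l a ν y * vfCoord e (Γ.nabla Y Z) ν y =
      ∑ b, vfCoord e Y b y * ∑ ν, christoffel e Γ l a ν y * w ν b y := by
    simp only [hYZ _ y hy, Finset.mul_sum]
    rw [Finset.sum_comm]
    exact Finset.sum_congr rfl fun _ _ => Finset.sum_congr rfl fun _ _ => by ring
  rw [h2, ← Finset.sum_add_distrib, ← Finset.sum_sub_distrib]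
  refine Finset.sum_congr rfl fun b _ => ?_
  rw [← (hdw l b a).2]
  ring

/-- The components of the curvature,
`∂_a Γ^l_{bc} - ∂_b Γ^l_{ac} + Γ^l_{aν} Γ^ν_{bc} - Γ^l_{bν} Γ^ν_{ac}`. -/
noncomputable def curvatureComponents {m : ℕ} (l : Fin m) (ρ : Fin 3 → Fin m) :
    MvPolynomial (JetVar m 0) ℝ :=
  MvPolynomial.X (.conn 1 ![ρ 0] l (ρ 1) (ρ 2)) - MvPolynomial.X (.conn 1 ![ρ 1] l (ρ 0) (ρ 2)) +
    (∑ ν, christoffelVar l (ρ 0) ν * christoffelVar ν (ρ 1) (ρ 2) -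
      ∑ ν, christoffelVar l (ρ 1) ν * christoffelVar ν (ρ 0) (ρ 2))

theorem hasComponents_curvatureOp (m : ℕ) :
    (curvatureOp.{u} m).HasComponents curvatureComponents := by
  intro M _ _ _ _ _ Γ X e he y hy l
  have hN : ∀ A B : SmoothVF m M, Γ.nablaLin A B = Γ.nabla A B := fun _ _ => rfl
  have h0 : curvatureOp m M Γ X = (Γ.nabla (X 0) (Γ.nabla (X 1) (X 2)) -
      Γ.nabla (Γ.nabla (X 0) (X 1)) (X 2)) - (Γ.nabla (X 1) (Γ.nabla (X 0) (X 2)) -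
      Γ.nabla (Γ.nabla (X 1) (X 0)) (X 2)) := by
    simp only [← hN]
    exact curvatureLin_apply _ _ _ _
  rw [h0, vfCoord_sub, vfCoord_hessian he Γ _ _ _ _ hy, vfCoord_hessian he Γ _ _ _ _ hy]
  conv_lhs =>
    enter [2]
    rw [Finset.sum_comm]
  rw [sum_fin_succ_fun, ← Finset.sum_sub_distrib]
  refine Finset.sum_congr rfl fun a _ => ?_
  rw [sum_fin_succ_fun, ← Finset.sum_sub_distrib]
  refine Finset.sum_congr rfl fun b _ => ?_
  rw [sum_fin_succ_fun]
  simp only [Finset.univ_unique, Finset.sum_singleton, Fin.prod_univ_three]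
  have hD : partialDeriv (vfCoord e (X 2) l) ![b, a] y =
      partialDeriv (vfCoord e (X 2) l) ![a, b] y :=
    partialDeriv_cons_cons e.open_target (contDiffOn_vfCoord he (X 2) l) Fin.elim0 b a hy
  have hS : ∀ ν, christoffel e Γ ν b a y = christoffel e Γ ν a b y :=
    fun ν => christoffel_symm he Γ ν b a hy
  have hR : ∀ c, connEval e Γ (curvatureComponents l ![a, b, c]) y =
      partialDeriv (christoffel e Γ l b c) ![a] y - partialDeriv (christoffel e Γ l a c) ![b] y +
      (∑ ν, christoffel e Γ l a ν y * christoffel e Γ ν b c y -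
        ∑ ν, christoffel e Γ l b ν y * christoffel e Γ ν a c y) := by
    intro c
    simp only [← connEval_christoffelVar]
    simp [connEval, curvatureComponents, jetValue]
  have hsum : ∀ c, (Fin.cons a (Fin.cons b (Fin.cons c default : Fin 1 → Fin m) :
      Fin 2 → Fin m) : Fin 3 → Fin m) = ![a, b, c] := by
    intro c
    funext i
    match i with
    | 0 => rfl
    | 1 => rfl
    | 2 => rfl
  simp only [hsum, hR]
  rw [mul_comm (vfCoord e (X 1) b y), ← mul_sub]
  simp only [Matrix.cons_val_zero, Matrix.cons_val_one, Matrix.cons_val, mul_assoc,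
    ← Finset.mul_sum]
  congr 2
  simp only [hD, hS, mul_add, Finset.sum_add_distrib, mul_sub, Finset.sum_sub_distrib,
    Finset.mul_sum]
  have h1 : ∀ a b : Fin m, ∑ c, ∑ ν, vfCoord e (X 2) c y *
      (christoffel e Γ l a ν y * christoffel e Γ ν b c y) =
      ∑ ν, ∑ c, christoffel e Γ l a ν y * (christoffel e Γ ν b c y * vfCoord e (X 2) c y) := by
    intro a b
    rw [Finset.sum_comm]
    exact Finset.sum_congr rfl fun _ _ => Finset.sum_congr rfl fun _ _ => by ring
  simp only [h1, mul_comm (vfCoord e (X 2) _ y) (partialDeriv _ _ _)]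
  ring

end Curvature

section IteratedCurvature

/-- The covariant derivatives `∇^q R` of the curvature, as operators in `q + 3` arguments. -/
noncomputable def iteratedCurvature (m : ℕ) : (q : ℕ) → OpFamily.{u} m (q + 1 + 2)
  | 0 => curvatureOp m
  | q + 1 => (iteratedCurvature m q).covDeriv

/-- The variable `∂^p Γ^l_{ρ_{p+1} ρ_{p+2}} / ∂x^{ρ₁} ⋯ ∂x^{ρ_p}`. -/
def leadingVar {m : ℕ} (p : ℕ) (l : Fin m) (ρ : Fin (p + 2) → Fin m) : JetVar m 0 :=
  .conn p (fun i => ρ (Fin.castAdd 2 i)) l (ρ (Fin.natAdd p 0)) (ρ (Fin.natAdd p 1))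

/-- The transposition of the last derivative index and the first lower index of the Christoffel
symbol in the leading term. -/
def mixedSwap (q : ℕ) : Equiv.Perm (Fin (q + 1 + 2)) :=
  Equiv.swap ⟨q, by omega⟩ ⟨q + 1, by omega⟩

theorem leadingVar_cons {m : ℕ} (p : ℕ) (l a : Fin m) (ρ : Fin (p + 2) → Fin m) :
    leadingVar (p + 1) l (Fin.cons a ρ : Fin (p + 2 + 1) → Fin m) =
      .conn (p + 1) (Fin.cons a fun i => ρ (Fin.castAdd 2 i)) l (ρ (Fin.natAdd p 0))
        (ρ (Fin.natAdd p 1)) := by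
  have h : (fun i : Fin (p + 1) => (Fin.cons a ρ : Fin (p + 2 + 1) → Fin m) (Fin.castAdd 2 i)) =
      Fin.cons a fun i => ρ (Fin.castAdd 2 i) := by
    funext i
    refine Fin.cases rfl (fun i => rfl) i
  rw [leadingVar]
  congr 1

theorem cons_comp_mixedSwap {α : Type*} (q : ℕ) (a : α) (ρ : Fin (q + 1 + 2) → α) :
    (Fin.cons a ρ : Fin (q + 1 + 2 + 1) → α) ∘ mixedSwap (q + 1) =
      Fin.cons a (ρ ∘ mixedSwap q) := by
  funext i
  refine Fin.cases ?_ (fun i => ?_) i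
  · simp only [Function.comp_apply, Fin.cons_zero, mixedSwap]
    rw [Equiv.swap_apply_of_ne_of_ne]
    · rfl
    · simp [Fin.ext_iff]
    · simp [Fin.ext_iff]
  · have h := (Fin.succ_injective (q + 1 + 2)).swap_apply
      (⟨q, by omega⟩ : Fin (q + 1 + 2)) ⟨q + 1, by omega⟩ i
    simp only [Function.comp_apply, Fin.cons_succ, mixedSwap]
    exact congrArg (Fin.cons a ρ : Fin (q + 1 + 2 + 1) → α) h

theorem isLower_leadingVar {m p : ℕ} (l : Fin m) (ρ : Fin (p + 2) → Fin m) :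
    (leadingVar p l ρ).IsLower (p + 1) :=
  Nat.lt_succ_self p

theorem christoffelVar_mem_lowerOrder {m p : ℕ} (l μ ν : Fin m) :
    christoffelVar l μ ν ∈ lowerOrder m 0 (p + 1) :=
  X_mem_lowerOrder (Nat.succ_pos p)

/-- The leading part of the components of `∇^q R` is the antisymmetrization of
`∂^{q+1} Γ` in the last derivative index and the first lower index. -/
theorem exists_components_iteratedCurvature (m q : ℕ) :
    ∃ T, (iteratedCurvature.{u} m q).HasComponents T ∧ ∀ l ρ,
      T l ρ - (MvPolynomial.X (leadingVar (q + 1) l ρ) -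
        MvPolynomial.X (leadingVar (q + 1) l (ρ ∘ mixedSwap q))) ∈ lowerOrder m 0 (q + 1) := by
  induction q with
  | zero =>
    refine ⟨curvatureComponents, hasComponents_curvatureOp m, fun l ρ => ?_⟩
    have h : curvatureComponents l ρ - (MvPolynomial.X (leadingVar 1 l ρ) -
        MvPolynomial.X (leadingVar 1 l (ρ ∘ mixedSwap 0))) =
        ∑ ν, christoffelVar l (ρ 0) ν * christoffelVar ν (ρ 1) (ρ 2) -
          ∑ ν, christoffelVar l (ρ 1) ν * christoffelVar ν (ρ 0) (ρ 2) := by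
      have h1 : leadingVar 1 l ρ = .conn 1 ![ρ 0] l (ρ 1) (ρ 2) := by
        rw [leadingVar]
        congr 1
        funext i
        rw [Subsingleton.elim i 0]
        rfl
      have h2 : leadingVar 1 l (ρ ∘ mixedSwap 0) = .conn 1 ![ρ 1] l (ρ 0) (ρ 2) := by
        rw [leadingVar]
        congr 1
        funext i
        rw [Subsingleton.elim i 0]
        rfl
      rw [h1, h2, curvatureComponents]
      ring
    rw [h]
    exact Subalgebra.sub_mem _
      (Subalgebra.sum_mem _ fun ν _ => Subalgebra.mul_mem _ (christoffelVar_mem_lowerOrder _ _ _)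
        (christoffelVar_mem_lowerOrder _ _ _))
      (Subalgebra.sum_mem _ fun ν _ => Subalgebra.mul_mem _ (christoffelVar_mem_lowerOrder _ _ _)
        (christoffelVar_mem_lowerOrder _ _ _))
  | succ q ih =>
    obtain ⟨T, hT, hlow⟩ := ih
    refine ⟨covDerivComponents T, hT.covDeriv, fun l ρ => ?_⟩
    obtain ⟨a, ρ, rfl⟩ : ∃ a ρ', ρ = (Fin.cons a ρ' : Fin (q + 1 + 2 + 1) → Fin m) :=
      ⟨ρ 0, Fin.tail ρ, (Fin.cons_self_tail ρ).symm⟩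
    have hTmem : ∀ l ρ, T l ρ ∈ lowerOrder m 0 (q + 2) := fun l ρ => by
      rw [← sub_add_cancel (T l ρ) (MvPolynomial.X (leadingVar (q + 1) l ρ) -
        MvPolynomial.X (leadingVar (q + 1) l (ρ ∘ mixedSwap q)))]
      exact Subalgebra.add_mem _ (lowerOrder_mono _ _ (Nat.le_succ _) (hlow l ρ))
        (Subalgebra.sub_mem _ (X_mem_lowerOrder (isLower_leadingVar _ _))
          (X_mem_lowerOrder (isLower_leadingVar _ _)))
    have hX : ∀ ρ : Fin (q + 1 + 2) → Fin m,
        totalDeriv a (MvPolynomial.X (leadingVar (q + 1) l ρ)) =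
          MvPolynomial.X (leadingVar (q + 1 + 1) l
            (Fin.cons a ρ : Fin (q + 1 + 2 + 1) → Fin m)) := fun ρ => by
      rw [leadingVar_cons, totalDeriv, MvPolynomial.mkDerivation_X, leadingVar]
    have hD := totalDeriv_mem_lowerOrder a (hlow l ρ)
    rw [map_sub, map_sub, hX, hX, ← cons_comp_mixedSwap] at hD
    simp only [covDerivComponents, Fin.cons_zero, Fin.tail_cons]
    have hsum1 : ∑ ν, christoffelVar l a ν * T ν ρ ∈ lowerOrder m 0 (q + 2) :=
      Subalgebra.sum_mem _ fun ν _ => Subalgebra.mul_mem _ (christoffelVar_mem_lowerOrder _ _ _)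
        (hTmem _ _)
    have hsum2 : ∑ i, ∑ ν, T l (Function.update ρ i ν) * christoffelVar ν a (ρ i) ∈
        lowerOrder m 0 (q + 2) :=
      Subalgebra.sum_mem _ fun i _ => Subalgebra.sum_mem _ fun ν _ =>
        Subalgebra.mul_mem _ (hTmem _ _) (christoffelVar_mem_lowerOrder _ _ _)
    have h := Subalgebra.sub_mem _ (Subalgebra.add_mem _ hD hsum1) hsum2
    convert h using 1
    ring

end IteratedCurvature

/-! ### Leading coefficients of operators -/

section LeadingCoefficients

/-- The value of the leading monomial of `σ`,
`X_{σ(1)}^{ρ₁} ⋯ X_{σ(n)}^{ρ_n} ∂^p Γ^l_{ρ_{n-1} ρ_n} / ∂x^{ρ₁} ⋯ ∂x^{ρ_p}`, where `n = p + 2`. -/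
noncomputable def leadingMonomial {m p : ℕ} {M : Type*} [TopologicalSpace M]
    [ChartedSpace (RealSpace m) M] [IsManifold (𝓡 m) ∞ M]
    (e : OpenPartialHomeomorph M (RealSpace m)) (Γ : SymConnection m M)
    (X : Fin (p + 2) → SmoothVF m M) (y : RealSpace m) (l : Fin m)
    (σ : Equiv.Perm (Fin (p + 2))) : ℝ :=
  ∑ ρ : Fin (p + 2) → Fin m, (∏ i, vfCoord e (X (σ i)) (ρ i) y) *
    jetValue e Γ Fin.elim0 y (leadingVar p l ρ)

theorem leadingMonomial_eq {m p : ℕ} {M : Type*} [TopologicalSpace M]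
    [ChartedSpace (RealSpace m) M] [IsManifold (𝓡 m) ∞ M]
    (e : OpenPartialHomeomorph M (RealSpace m)) (Γ : SymConnection m M)
    (X : Fin (p + 2) → SmoothVF m M) (y : RealSpace m) (l : Fin m)
    (σ : Equiv.Perm (Fin (p + 2))) :
    leadingMonomial e Γ X y l σ = ∑ ρ : Fin (p + 2) → Fin m, (∏ i, vfCoord e (X i) (ρ i) y) *
      jetValue e Γ Fin.elim0 y (leadingVar p l (ρ ∘ σ)) := by
  rw [leadingMonomial, ← Equiv.sum_comp (σ.symm.arrowCongr (Equiv.refl (Fin m)))]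
  refine Finset.sum_congr rfl fun ρ _ => ?_
  rw [← Equiv.prod_comp σ (fun i => vfCoord e (X i) (ρ i) y)]
  rfl

/-- The leading monomial only depends on the coset of the permutation, because partial derivatives
commute and the Christoffel symbols are symmetric. -/
theorem leadingMonomial_mul {m p : ℕ} {M : Type*} [TopologicalSpace M]
    [ChartedSpace (RealSpace m) M] [IsManifold (𝓡 m) ∞ M] [T2Space M]
    {e : OpenPartialHomeomorph M (RealSpace m)} (he : e ∈ IsManifold.maximalAtlas (𝓡 m) ∞ M)
    (Γ : SymConnection m M) (X : Fin (p + 2) → SmoothVF m M) {y : RealSpace m}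
    (hy : y ∈ e.target) (l : Fin m) (σ h : Equiv.Perm (Fin (p + 2))) (hh : h ∈ youngSubgroup p) :
    leadingMonomial e Γ X y l (σ * h) = leadingMonomial e Γ X y l σ := by
  have hmem : ∀ i : Fin (p + 2), (h i).val < p ↔ i.val < p := fun i => by
    have h1 := MulAction.mem_stabilizer_iff.1 hh
    have h2 : h • i ∈ h • {i : Fin (p + 2) | i.val < p} ↔ i ∈ {i : Fin (p + 2) | i.val < p} :=
      Set.smul_mem_smul_set_iff
    rw [h1] at h2
    exact h2
  have key : ∀ ρ : Fin (p + 2) → Fin m, jetValue e Γ Fin.elim0 y (leadingVar p l (ρ ∘ h)) =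
      jetValue e Γ Fin.elim0 y (leadingVar p l ρ) := by
    intro ρ
    -- `h` permutes the first `p` indices, and fixes or exchanges the last two.
    let g : Fin p → Fin p := fun i => ⟨(h (Fin.castAdd 2 i)).val, (hmem _).2 i.2⟩
    have hg : Function.Injective g := fun i j hij => by
      have h1 : h (Fin.castAdd 2 i) = h (Fin.castAdd 2 j) := 
        Fin.ext (congrArg (fun k : Fin p => k.val) hij)
      exact Fin.ext (congrArg Fin.val (h.injective h1) :)
    let τ : Equiv.Perm (Fin p) := Equiv.ofBijective g (Finite.injective_iff_bijective.1 hg)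
    have hτ : (fun i : Fin p => (ρ ∘ h) (Fin.castAdd 2 i)) =
        (fun i : Fin p => ρ (Fin.castAdd 2 i)) ∘ τ := by
      funext i
      exact congrArg ρ (Fin.ext rfl)
    have h0 : ¬ (h (Fin.natAdd p 0)).val < p := fun hlt => by
      have := (hmem _).1 hlt
      simp at this
    have h1 : ¬ (h (Fin.natAdd p 1)).val < p := fun hlt => by
      have := (hmem _).1 hlt
      simp at this
    have hne : (h (Fin.natAdd p 0)).val ≠ (h (Fin.natAdd p 1)).val := fun heq => by
      have := h.injective (Fin.ext heq)
      simp [Fin.ext_iff] at this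
    have hcases : (h (Fin.natAdd p 0) = Fin.natAdd p 0 ∧ h (Fin.natAdd p 1) = Fin.natAdd p 1) ∨
        (h (Fin.natAdd p 0) = Fin.natAdd p 1 ∧ h (Fin.natAdd p 1) = Fin.natAdd p 0) := by
      have b0 := (h (Fin.natAdd p 0)).isLt
      have b1 := (h (Fin.natAdd p 1)).isLt
      simp only [Fin.ext_iff, Fin.val_natAdd, Fin.val_zero, Fin.val_one]
      omega
    have hs := contDiffOn_christoffel he Γ
    simp only [leadingVar, jetValue, hτ]
    rw [partialDeriv_comp_perm e.open_target (hs _ _ _) _ _ hy]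
    rcases hcases with ⟨ha, hb⟩ | ⟨ha, hb⟩
    · simp only [Function.comp_apply, ha, hb]
    · simp only [Function.comp_apply, ha, hb]
      exact partialDeriv_congr e.open_target
        (fun z hz => christoffel_symm he Γ _ _ _ hz) _ hy
  rw [leadingMonomial_eq, leadingMonomial_eq]
  refine Finset.sum_congr rfl fun ρ _ => ?_
  rw [Equiv.Perm.coe_mul, ← Function.comp_assoc, key]

/-- The operator `O` is of order `0` in the vector fields, and is given by the combination of the
leading monomials with coefficients `a`, up to terms of lower order. -/
def OpFamily.HasLeadingCoeffs {m p : ℕ} (O : OpFamily.{u} m (p + 2))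
    (a : Equiv.Perm (Fin (p + 2)) → ℝ) : Prop :=
  ∃ Q : Fin m → MvPolynomial (JetVar m (p + 2)) ℝ, (∀ l, Q l ∈ lowerOrder m (p + 2) p) ∧
    ∀ (M : Type u) [TopologicalSpace M] [ChartedSpace (RealSpace m) M] [IsManifold (𝓡 m) ∞ M]
      [T2Space M] [SecondCountableTopology M] (Γ : SymConnection m M)
      (X : Fin (p + 2) → SmoothVF m M),
      ∀ e ∈ IsManifold.maximalAtlas (𝓡 m) ∞ M, ∀ y ∈ e.target, ∀ l : Fin m,
        vfCoord e (O M Γ X) l y = ∑ σ, a σ * leadingMonomial e Γ X y l σ +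
          MvPolynomial.eval (jetValue e Γ X y) (Q l)

/-- The jet variables of a connection, among those of a connection and `d` vector fields. -/
def JetVar.ofConn {m : ℕ} (d : ℕ) : JetVar m 0 → JetVar m d
  | .conn k ρ l μ ν => .conn k ρ l μ ν
  | .vf i _ _ _ => i.elim0

/-- The action of a permutation of the vector fields on the jet variables. -/
def JetVar.permute {m d : ℕ} (τ : Equiv.Perm (Fin d)) : JetVar m d → JetVar m d
  | .conn k ρ l μ ν => .conn k ρ l μ ν
  | .vf i k ρ l => .vf (τ i) k ρ l

theorem rename_mem_lowerOrder {m d d' p : ℕ} (f : JetVar m d → JetVar m d')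
    (hf : ∀ v, v.IsLower p → (f v).IsLower p) {P : MvPolynomial (JetVar m d) ℝ}
    (hP : P ∈ lowerOrder m d p) : MvPolynomial.rename f P ∈ lowerOrder m d' p := by
  have h : lowerOrder m d p ≤ (lowerOrder m d' p).comap (MvPolynomial.rename (R := ℝ) f) := by
    refine Algebra.adjoin_le ?_
    rintro _ ⟨v, hv, rfl⟩
    change MvPolynomial.rename f (MvPolynomial.X v : MvPolynomial (JetVar m d) ℝ) ∈
      lowerOrder m d' p
    rw [MvPolynomial.rename_X]
    exact X_mem_lowerOrder (hf v hv)
  exact h hP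

namespace OpFamily

/-- The permuted operator `(X₁, …, X_d) ↦ O(Γ, X_{τ(1)}, …, X_{τ(d)})`. -/
noncomputable def permute {m d : ℕ} (O : OpFamily.{u} m d) (τ : Equiv.Perm (Fin d)) :
    OpFamily.{u} m d :=
  fun M _ _ _ _ _ Γ => (O M Γ).domDomCongr τ

/-- A linear combination of operators. -/
noncomputable def linearCombination {m d : ℕ} {ι : Type*} (s : Finset ι) (c : ι → ℝ)
    (O : ι → OpFamily.{u} m d) : OpFamily.{u} m d :=
  fun M _ _ _ _ _ Γ => ∑ i ∈ s, c i • O i M Γ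

variable {m p : ℕ}

theorem HasLeadingCoeffs.permute {O : OpFamily.{u} m (p + 2)}
    {a : Equiv.Perm (Fin (p + 2)) → ℝ} (h : O.HasLeadingCoeffs a)
    (τ : Equiv.Perm (Fin (p + 2))) :
    (O.permute τ).HasLeadingCoeffs fun σ => a (τ⁻¹ * σ) := by
  obtain ⟨Q, hQ, hO⟩ := h
  refine ⟨fun l => MvPolynomial.rename (JetVar.permute τ) (Q l), fun l =>
    rename_mem_lowerOrder _ (fun v hv => ?_) (hQ l), ?_⟩
  · rcases v with ⟨k, ρ, l, μ, ν⟩ | ⟨i, k, ρ, l⟩ <;> exact hv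
  · intro M _ _ _ _ _ Γ X e he y hy l
    refine (hO M Γ (fun i => X (τ i)) e he y hy l).trans ?_
    congr 1
    · rw [← Equiv.sum_comp (Equiv.mulLeft τ)
        fun σ => a (τ⁻¹ * σ) * leadingMonomial e Γ X y l σ]
      refine Finset.sum_congr rfl fun σ _ => ?_
      rw [Equiv.coe_mulLeft, inv_mul_cancel_left]
      rfl
    · rw [MvPolynomial.eval_rename]
      congr 1
      congr 1
      funext v
      cases v <;> rfl

theorem HasLeadingCoeffs.linearCombination {ι : Type*} (s : Finset ι) (c : ι → ℝ)
    {O : ι → OpFamily.{u} m (p + 2)} {a : ι → Equiv.Perm (Fin (p + 2)) → ℝ}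
    (h : ∀ i, (O i).HasLeadingCoeffs (a i)) :
    (OpFamily.linearCombination s c O).HasLeadingCoeffs fun σ => ∑ i ∈ s, c i * a i σ := by
  choose Q hQ hO using h
  refine ⟨fun l => ∑ i ∈ s, c i • Q i l, fun l => Subalgebra.sum_mem _ fun i _ =>
    Subalgebra.smul_mem _ (hQ i l) _, ?_⟩
  intro M _ _ _ _ _ Γ X e he y hy l
  simp only [OpFamily.linearCombination, sum_apply, smul_apply, vfCoord_sum, vfCoord_smul,
    hO _ M Γ X e he y hy l, map_sum, MvPolynomial.smul_eval, mul_add, Finset.sum_add_distrib]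
  congr 1
  simp only [Finset.mul_sum, Finset.sum_mul]
  rw [Finset.sum_comm]
  exact Finset.sum_congr rfl fun _ _ => Finset.sum_congr rfl fun _ _ => by ring

/-- Leading coefficients may be replaced by others that define the same leading term. -/
theorem HasLeadingCoeffs.congr {O : OpFamily.{u} m (p + 2)}
    {a b : Equiv.Perm (Fin (p + 2)) → ℝ} (h : O.HasLeadingCoeffs a)
    (hab : ∀ f : Equiv.Perm (Fin (p + 2)) → ℝ,
      (∀ σ, ∀ τ ∈ youngSubgroup p, f (σ * τ) = f σ) → ∑ σ, a σ * f σ = ∑ σ, b σ * f σ) :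
    O.HasLeadingCoeffs b := by
  obtain ⟨Q, hQ, hO⟩ := h
  refine ⟨Q, hQ, ?_⟩
  intro M _ _ _ _ _ Γ X e he y hy l
  rw [hO M Γ X e he y hy l, hab _ fun σ τ hτ => leadingMonomial_mul he Γ X hy l σ τ hτ]

theorem hasLeadingCoeffs_zero :
    (OpFamily.linearCombination (∅ : Finset (Fin 0)) 0 Fin.elim0 :
      OpFamily.{u} m (p + 2)).HasLeadingCoeffs 0 := by
  refine ⟨0, fun l => Subalgebra.zero_mem _, ?_⟩
  intro M _ _ _ _ _ Γ X e he y hy l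
  simp [OpFamily.linearCombination, vfCoord_zero]

theorem hasLeadingCoeffs_iteratedCurvature (m q : ℕ) :
    (iteratedCurvature.{u} m q).HasLeadingCoeffs
      (Pi.single 1 1 - Pi.single (mixedSwap q) 1) := by
  obtain ⟨T, hT, hlow⟩ := exists_components_iteratedCurvature.{u} m q
  let R : Fin m → (Fin (q + 1 + 2) → Fin m) → MvPolynomial (JetVar m 0) ℝ := fun l ρ =>
    T l ρ - (MvPolynomial.X (leadingVar (q + 1) l ρ) -
      MvPolynomial.X (leadingVar (q + 1) l (ρ ∘ mixedSwap q)))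
  refine ⟨fun l => ∑ ρ : Fin (q + 1 + 2) → Fin m,
    (∏ i, MvPolynomial.X (JetVar.vf i 0 Fin.elim0 (ρ i))) *
      MvPolynomial.rename (JetVar.ofConn (q + 1 + 2)) (R l ρ), fun l => ?_, ?_⟩
  · refine Subalgebra.sum_mem _ fun ρ _ => Subalgebra.mul_mem _
      (Subalgebra.prod_mem _ fun i _ => X_mem_lowerOrder rfl)
      (rename_mem_lowerOrder _ (fun v hv => ?_) (hlow l ρ))
    rcases v with ⟨k, ρ, l, μ, ν⟩ | ⟨i, k, ρ, l⟩
    · exact hv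
    · exact i.elim0
  · intro M _ _ _ _ _ Γ X e he y hy l
    have hren : ∀ P : MvPolynomial (JetVar m 0) ℝ, MvPolynomial.eval (jetValue e Γ X y)
        (MvPolynomial.rename (JetVar.ofConn (q + 1 + 2)) P) = connEval e Γ P y := by
      intro P
      rw [MvPolynomial.eval_rename, connEval]
      congr 2
      funext v
      rcases v with ⟨k, ρ, l, μ, ν⟩ | ⟨i, k, ρ, l⟩
      · rfl
      · exact i.elim0
    have hT' : ∀ ρ, connEval e Γ (T l ρ) y = connEval e Γ (R l ρ) y +
        (jetValue e Γ Fin.elim0 y (leadingVar (q + 1) l ρ) -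
          jetValue e Γ Fin.elim0 y (leadingVar (q + 1) l (ρ ∘ mixedSwap q))) := fun ρ => by
      simp [R, connEval]
    have hlead : ∑ σ, (Pi.single 1 1 - Pi.single (mixedSwap q) 1 :
        Equiv.Perm (Fin (q + 1 + 2)) → ℝ) σ * leadingMonomial e Γ X y l σ =
        leadingMonomial e Γ X y l 1 - leadingMonomial e Γ X y l (mixedSwap q) := by
      simp [sub_mul, Finset.sum_sub_distrib, Pi.single_apply]
    rw [hT M Γ X e he y hy l, hlead, leadingMonomial_eq, leadingMonomial_eq]
    simp only [hT', map_sum, map_mul, map_prod, MvPolynomial.eval_X, hren, jetValue,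
      partialDeriv_zero, mul_add, mul_sub, Finset.sum_add_distrib, Finset.sum_sub_distrib,
      Equiv.Perm.coe_one, Function.comp_id]
    ring

end OpFamily

end LeadingCoefficients

/-! ### Operators with prescribed leading term -/

section Construction

/-- The coefficient vectors that occur as leading coefficients of operators. As different vectors
may define the same leading term, this contains all vectors that vanish on functions which are
constant on the cosets of the Young subgroup. -/
def realizableCoeffs (m p : ℕ) : Submodule ℝ (Equiv.Perm (Fin (p + 2)) → ℝ) where
  carrier := {a | ∃ O : OpFamily.{u} m (p + 2), O.HasLeadingCoeffs a}
  zero_mem' := ⟨_, OpFamily.hasLeadingCoeffs_zero⟩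
  add_mem' := by
    rintro a b ⟨O, hO⟩ ⟨O', hO'⟩
    refine ⟨OpFamily.linearCombination (Finset.univ : Finset Bool) 1 fun i => cond i O O', ?_⟩
    have h := OpFamily.HasLeadingCoeffs.linearCombination (Finset.univ : Finset Bool) 1
      (O := fun i => cond i O O') (a := fun i => cond i a b) (by rintro (_ | _) <;> assumption)
    convert h using 1
    funext σ
    simp
  smul_mem' := by
    rintro c a ⟨O, hO⟩
    refine ⟨OpFamily.linearCombination (Finset.univ : Finset Unit) (fun _ => c) fun _ => O, ?_⟩
    have h := OpFamily.HasLeadingCoeffs.linearCombination (Finset.univ : Finset Unit)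
      (fun _ => c) (O := fun _ => O) fun _ => hO
    convert h using 1
    funext σ
    simp

variable {m p : ℕ}

theorem translate_mem_realizableCoeffs {a : Equiv.Perm (Fin (p + 2)) → ℝ}
    (ha : a ∈ realizableCoeffs.{u} m p) (τ : Equiv.Perm (Fin (p + 2))) :
    (fun σ => a (τ⁻¹ * σ)) ∈ realizableCoeffs.{u} m p := by
  obtain ⟨O, hO⟩ := ha
  exact ⟨O.permute τ, hO.permute τ⟩

theorem single_translate (τ g : Equiv.Perm (Fin (p + 2))) :
    (fun σ => (Pi.single g 1 : Equiv.Perm (Fin (p + 2)) → ℝ) (τ⁻¹ * σ)) =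
      Pi.single (τ * g) 1 := by
  funext σ
  simp only [Pi.single_apply, inv_mul_eq_iff_eq_mul]

theorem single_sub_single_mem_of_young {h : Equiv.Perm (Fin (p + 2))} (hh : h ∈ youngSubgroup p) :
    (Pi.single 1 1 - Pi.single h 1 : Equiv.Perm (Fin (p + 2)) → ℝ) ∈
      realizableCoeffs.{u} m p := by
  refine ⟨_, OpFamily.hasLeadingCoeffs_zero.congr fun f hf => ?_⟩
  have h1 := hf 1 h hh
  rw [one_mul] at h1
  simp [sub_mul, Finset.sum_sub_distrib, Pi.single_apply, h1]

theorem swap_mem_youngSubgroup {i j : Fin (p + 2)} (hij : i.val < p ↔ j.val < p) :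
    Equiv.swap i j ∈ youngSubgroup p := by
  rw [youngSubgroup, MulAction.mem_stabilizer_iff]
  ext k
  rw [Set.mem_smul_set_iff_inv_smul_mem, Equiv.swap_inv]
  simp only [Equiv.Perm.smul_def, Set.mem_ofPred_eq]
  by_cases h1 : k = i
  · subst h1
    rw [Equiv.swap_apply_left, hij]
  · by_cases h2 : k = j
    · subst h2
      rw [Equiv.swap_apply_right, hij]
    · rw [Equiv.swap_apply_of_ne_of_ne h1 h2]

/-- The Young subgroup and the mixed transposition generate the symmetric group, so that all
differences of leading monomials are leading terms of operators. -/
theorem single_sub_single_mem (q : ℕ) (g : Equiv.Perm (Fin (q + 1 + 2))) :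
    (Pi.single 1 1 - Pi.single g 1 : Equiv.Perm (Fin (q + 1 + 2)) → ℝ) ∈
      realizableCoeffs.{u} m (q + 1) := by
  have hg : g ∈ Submonoid.closure
      (Set.range fun i : Fin (q + 2) => Equiv.swap i.castSucc i.succ) := by
    rw [Equiv.Perm.mclosure_swap_castSucc_succ]
    trivial
  induction hg using Submonoid.closure_induction with
  | mem x hx =>
    obtain ⟨i, rfl⟩ := hx
    -- The transposition of positions `q` and `q + 1` is the only adjacent one outside of the
    -- Young subgroup.
    by_cases hi : i.val = q
    · have h : Equiv.swap i.castSucc i.succ = mixedSwap q := by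
        rw [mixedSwap]
        congr 1
        · exact Fin.ext hi
        · exact Fin.ext (congrArg Nat.succ hi)
      beta_reduce
      rw [h]
      exact ⟨_, OpFamily.hasLeadingCoeffs_iteratedCurvature m q⟩
    · refine single_sub_single_mem_of_young (swap_mem_youngSubgroup ?_)
      simp only [Fin.val_castSucc, Fin.val_succ]
      omega
  | one => simp
  | mul x y _ _ hx hy =>
    -- `M_1 - M_{xy} = (M_1 - M_x) + (M_x - M_{xy})`, the second term being a translate of
    -- `M_1 - M_y`.
    have h := translate_mem_realizableCoeffs hy x
    have h2 : (fun σ => (Pi.single 1 1 - Pi.single y 1 : Equiv.Perm (Fin (q + 1 + 2)) → ℝ)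
        (x⁻¹ * σ)) = Pi.single x 1 - Pi.single (x * y) 1 := by
      rw [← single_translate x y]
      conv_rhs => rw [← mul_one x, ← single_translate x 1]
      simp only [mul_one]
      rfl
    rw [h2] at h
    have h3 := Submodule.add_mem _ hx h
    rwa [sub_add_sub_cancel] at h3

theorem mem_realizableCoeffs_of_sum_eq_zero (q : ℕ) {a : Equiv.Perm (Fin (q + 1 + 2)) → ℝ}
    (ha : ∑ σ, a σ = 0) : a ∈ realizableCoeffs.{u} m (q + 1) := by
  have h : a = -∑ g, a g • (Pi.single 1 1 - Pi.single g 1 :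
      Equiv.Perm (Fin (q + 1 + 2)) → ℝ) := by
    funext σ
    simp [Finset.sum_apply, mul_sub, Finset.sum_sub_distrib, ha, Pi.single_apply]
  rw [h]
  exact Submodule.neg_mem _ (Submodule.sum_mem _ fun g _ =>
    Submodule.smul_mem _ _ (single_sub_single_mem q g))

/-- The zero operator. -/
noncomputable def zeroNatOp (m d : ℕ) : NatOp.{u} m d where
  op := fun _ _ _ _ _ _ _ => 0
  natural := ⟨0, fun M _ _ _ _ _ Γ X e he y hy l => by simp [vfCoord_zero]⟩

/-- An operator that is invariant under the Young subgroup, and whose leading term is the leading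
monomial of the identity minus a multiple of the sum of all leading monomials. -/
theorem exists_youngInvariant_op (m q : ℕ) : ∃ (B : OpFamily.{u} m (q + 1 + 2)) (c : ℝ),
    (∀ τ ∈ youngSubgroup (q + 1), B.permute τ = B) ∧
      B.HasLeadingCoeffs
        fun σ => (Pi.single 1 1 : Equiv.Perm (Fin (q + 1 + 2)) → ℝ) σ - c := by
  classical
  set c : ℝ := (Fintype.card (Equiv.Perm (Fin (q + 1 + 2))) : ℝ)⁻¹ with hc
  have hG : (Fintype.card (Equiv.Perm (Fin (q + 1 + 2))) : ℝ) ≠ 0 :=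
    Nat.cast_ne_zero.2 Fintype.card_ne_zero
  obtain ⟨B₀, hB₀⟩ : (fun σ => (Pi.single 1 1 : Equiv.Perm (Fin (q + 1 + 2)) → ℝ) σ - c) ∈
      realizableCoeffs.{u} m (q + 1) :=
    mem_realizableCoeffs_of_sum_eq_zero q (by
      simp [Finset.sum_sub_distrib, hc, hG])
  let H := youngSubgroup (q + 1)
  set k : ℝ := (Fintype.card H : ℝ)⁻¹ with hk
  have hH : (Fintype.card H : ℝ) ≠ 0 := Nat.cast_ne_zero.2 Fintype.card_ne_zero
  refine ⟨OpFamily.linearCombination (Finset.univ : Finset H) (fun _ => k)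
    fun h => B₀.permute h, c, ?_, ?_⟩
  · intro τ hτ
    funext M _ _ _ _ _ Γ
    ext1 X
    simp only [OpFamily.permute, OpFamily.linearCombination, MultilinearMap.domDomCongr_apply,
      sum_apply, smul_apply]
    exact Equiv.sum_comp (Equiv.mulLeft (⟨τ, hτ⟩ : H))
      fun h : H => k • B₀ M Γ (fun i => X ((h : Equiv.Perm (Fin (q + 1 + 2))) i))
  · refine (OpFamily.HasLeadingCoeffs.linearCombination (Finset.univ : Finset H) (fun _ => k)
      (fun h : H => hB₀.permute (h : Equiv.Perm (Fin (q + 1 + 2))))).congr fun f hf => ?_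
    have h1 : ∀ h : H, ∑ σ, ((Pi.single 1 1 : Equiv.Perm (Fin (q + 1 + 2)) → ℝ)
        ((h : Equiv.Perm (Fin (q + 1 + 2)))⁻¹ * σ) - c) * f σ =
        ∑ σ, ((Pi.single 1 1 : Equiv.Perm (Fin (q + 1 + 2)) → ℝ) σ - c) * f σ := by
      intro h
      have h2 := hf 1 h h.2
      rw [one_mul] at h2
      simp [sub_mul, Finset.sum_sub_distrib, Pi.single_apply, inv_mul_eq_one, h2]
    simp only [Finset.sum_mul]
    rw [Finset.sum_comm]
    simp only [mul_assoc, ← Finset.mul_sum]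
    rw [Finset.sum_congr rfl fun h _ => h1 h, Finset.sum_const, Finset.card_univ,
      nsmul_eq_mul, ← mul_assoc, hk, inv_mul_cancel₀ hH,
      one_mul]

/-- Natural operators with prescribed leading coefficients of sum zero, all of whose
quasi-symmetries are symmetries. -/
theorem exists_natOp_of_sum_eq_zero (m q : ℕ) (α : Equiv.Perm (Fin (q + 1 + 2)) → ℝ)
    (hα : ∑ σ ∈ Ush (q + 1), α σ = 0) :
    ∃ J : NatOp.{u} m (q + 1 + 2), J.HasLeadingTerm α ∧
      ∀ s : MonoidAlgebra ℝ (Equiv.Perm (Fin (q + 1 + 2))),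
        IsQuasiSymmetry α s → J.IsSymmetry s := by
  classical
  obtain ⟨B, c, hinv, hB⟩ := exists_youngInvariant_op.{u} m q
  let O : OpFamily.{u} m (q + 1 + 2) :=
    OpFamily.linearCombination (Ush (q + 1)) α fun σ => B.permute σ
  have hO : O.HasLeadingCoeffs fun σ => if σ ∈ Ush (q + 1) then α σ else 0 := by
    have h := OpFamily.HasLeadingCoeffs.linearCombination (Ush (q + 1)) α
      fun σ => hB.permute σ
    convert h using 1
    funext τ
    simp [mul_sub, Finset.sum_sub_distrib, ← Finset.sum_mul, hα, Pi.single_apply,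
      inv_mul_eq_one]
  obtain ⟨Q, hQ, hloc⟩ := hO
  have hexpr : O.HasLocalExpression fun l => leadingTerm m α l + Q l := by
    intro M _ _ _ _ _ Γ X e he y hy l
    rw [hloc M Γ X e he y hy l, map_add]
    congr 1
    simp only [leadingTerm, map_sum, map_mul, map_prod, MvPolynomial.eval_X, MvPolynomial.eval_C,
      jetValue, partialDeriv_zero, ite_mul, zero_mul, Finset.sum_ite_mem, Finset.univ_inter]
    rfl
  refine ⟨⟨O, _, hexpr⟩, ⟨Q, fun l v hv => MvPolynomial.mem_supported.1 (hQ l) hv, hexpr⟩, ?_⟩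
  intro s hs M _ _ _ _ _ Γ X
  -- The operator obtained from `B` by permuting the arguments depends on the coset only.
  let φ : Equiv.Perm (Fin (q + 1 + 2)) ⧸ youngSubgroup (q + 1) → SmoothVF m M :=
    Quotient.lift (fun σ : Equiv.Perm (Fin (q + 1 + 2)) => B M Γ fun i => X (σ i)) (by
      intro σ τ hστ
      have h1 : σ⁻¹ * τ ∈ youngSubgroup (q + 1) := QuotientGroup.leftRel_apply.1 hστ
      have h2 : (B.permute (σ⁻¹ * τ)) M Γ (fun i => X (σ i)) = B M Γ (fun i => X (σ i)) := by
        rw [hinv _ h1]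
      refine h2.symm.trans ?_
      simp [OpFamily.permute])
  let Φ : InducedModule (q + 1) →ₗ[ℝ] SmoothVF m M := Finsupp.linearCombination ℝ φ
  have h0 : Φ (InducedModule.act s (leadingElement α)) = 0 := by
    rw [show InducedModule.act s (leadingElement α) = 0 from hs, map_zero]
  rw [← h0, InducedModule.act, map_sum]
  refine Finset.sum_congr rfl fun τ _ => ?_
  rw [map_smul, leadingElement, Finsupp.mapDomain_finsetSum, map_sum]
  congr 1
  simp only [O, OpFamily.linearCombination, sum_apply, smul_apply]
  refine Finset.sum_congr rfl fun σ _ => ?_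
  rw [Finsupp.mapDomain_single, Finsupp.linearCombination_single]
  rfl

end Construction

theorem theoremE (m : ℕ) (α : (p : ℕ) → Equiv.Perm (Fin (p + 2)) → ℝ)
    (hα : ∀ p, 1 ≤ p → ∑ σ ∈ Ush p, α p σ = 0) :
    ∃ J : (p : ℕ) → NatOp.{u} m (p + 2),
      ∀ p, 1 ≤ p → (J p).HasLeadingTerm (α p) ∧
        ∀ s : MonoidAlgebra ℝ (Equiv.Perm (Fin (p + 2))),
          IsQuasiSymmetry (α p) s → (J p).IsSymmetry s := by
  choose J hJ using fun q => exists_natOp_of_sum_eq_zero.{u} m q (α (q + 1))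
    (hα (q + 1) (Nat.succ_pos q))
  -- Nothing is asked of the operator for `p = 0`.
  refine ⟨fun p => match p with
    | 0 => zeroNatOp m 2
    | q + 1 => J q, fun p hp => ?_⟩
  obtain ⟨q, rfl⟩ := Nat.exists_eq_add_of_le' hp
  exact hJ q
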